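/- **Theorem (Learning shallow quantum circuits).** A depth-$d$ circuit on a set of qubits is a sequence of at most $d$ layers, each layer consisting of arbitrary one- and two-qubit unitary gates acting on pairwise disjoint sets of qubits (no connectivity is prescribed). For an $n$-qubit unitary $U$, a *randomized measurement dataset* $\mathcal T_U(N)$ of size $N$ consists of $N$ independent pairs $(|\psi_\ell\rangle,|\phi_\ell\rangle)$, each obtained as follows: $|\psi_\ell\rangle=\bigotimes_{i=1}^n|\psi_{\ell,i}\rangle$ with the $|\psi_{\ell,i}\rangle$ independent and uniformly random in $\{|0\rangle,|1\rangle,|+\rangle,|-\rangle,|y+\rangle,|y-\rangle\}$; then each qubit of $U|\psi_\ell\rangle$ is measured in an independent uniformly random Pauli basis $X$, $Y$ or $Z$, and $|\phi_\ell\rangle=\bigotimes_{i=1}^n|\phi_{\ell,i}\rangle$ is the resulting product state. For every $d$ there are constants $C>0$ and $D$, depending only on $d$, such that the following holds for all $n\ge 1$, $\varepsilon>0$ and $\delta\in(0,1)$ with $n/\delta\ge 2$ (which is automatic for $n\ge2$), and for every integer $$N\;\ge\; C\,\frac{n^2\log(n/\delta)}{\varepsilon^2}.$$ There is a learning procedure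 (a map from datasets of size $N$ to circuits, which may depend on $d,n,N,\delta,\varepsilon$ but not on the unknown unitary) that outputs a quantum circuit $W$ of depth at most $D$ on $2n$ qubits, such that for every $n$-qubit unitary $U$ implemented by an $n$-qubit circuit of depth at most $d$, with probability at least $1-\delta$ over $\mathcal T_U(N)$, the $n$-qubit channel $$\hat{\mathcal E}(\rho)=\mathrm{Tr}_{>n}\!\left(W\,(\rho\otimes|0^n\rangle\langle 0^n|)\,W^\dagger\right)$$ implemented by the learned circuit satisfies $$\|\hat{\mathcal E}-\mathcal U\|_\diamond\le\varepsilon,\qquad \mathcal U(\rho)=U\rho U^\dagger .$$ Here $\|\mathcal E-\mathcal F\|_\diamond=\sup_\rho\|(\mathcal E\otimes I)(\rho)-(\mathcal F\otimes I)(\rho)\|_1$, the supremum being over all density matrices $\rho$ of the system together with a finite-dimensional reference system, and $\|A\|_1=\mathrm{Tr}\sqrt{A^\dagger A}$. -/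

import Mathlib

open MeasureTheory
open scoped ComplexOrder ENNReal Matrix

/-! ### Qubit registers, gates and circuits -/

/-- Operators on a register of qubits labelled by `ι`, as matrices in the computational basis:
the basis states are the bit strings `ι → Fin 2`. -/
abbrev QOp (ι : Type) : Type := Matrix (ι → Fin 2) (ι → Fin 2) ℂ

/-- An arbitrary one-qubit or two-qubit gate on a register `ι`: the set of qubits it acts on,
and a unitary on these qubits. -/
structure QGate (ι : Type) [DecidableEq ι] where
  supp : Finset ι
  supp_card : supp.card = 1 ∨ supp.card = 2
  mat : Matrix.unitaryGroup (supp → Fin 2) ℂ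

/-- The operator of a gate on the whole register: the gate tensored with the identity on the
qubits outside its support. -/
def QGate.toOp {ι : Type} [Fintype ι] [DecidableEq ι] (g : QGate ι) : QOp ι :=
  Matrix.of fun x y =>
    if ∀ i, i ∉ g.supp → x i = y i then
      (g.mat : Matrix (g.supp → Fin 2) (g.supp → Fin 2) ℂ) (fun i => x i) (fun i => y i)
    else 0

/-- One layer of a circuit: gates acting in parallel, on pairwise disjoint sets of qubits. -/
structure QLayer (ι : Type) [DecidableEq ι] where
  gates : List (QGate ι)
  disjoint : gates.Pairwise fun g h => Disjoint g.supp h.supp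

/-- The operator of a layer (its gates commute, so the order is immaterial). -/
def QLayer.toOp {ι : Type} [Fintype ι] [DecidableEq ι] (L : QLayer ι) : QOp ι :=
  (L.gates.map QGate.toOp).prod

/-- A quantum circuit: a list of layers, the head of the list being applied first.
No connectivity between the qubits is prescribed. -/
abbrev QCircuit (ι : Type) [DecidableEq ι] : Type := List (QLayer ι)

/-- The depth of a circuit is its number of layers. -/
def QCircuit.depth {ι : Type} [DecidableEq ι] (c : QCircuit ι) : ℕ := List.length c

/-- The operator implemented by a circuit `L₁, …, L_d`, namely `L_d ⋯ L₁`. -/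
def QCircuit.toOp {ι : Type} [Fintype ι] [DecidableEq ι] (c : QCircuit ι) : QOp ι :=
  ((List.map QLayer.toOp c).reverse).prod

/-! ### Channels and the diamond distance -/

/-- The unitary channel `ρ ↦ U ρ U†`. -/
def unitaryChannel {ι : Type} [Fintype ι] [DecidableEq ι] (U : QOp ι) : QOp ι →ₗ[ℂ] QOp ι where
  toFun ρ := U * ρ * Uᴴ
  map_add' ρ σ := by simp [Matrix.mul_add, Matrix.add_mul]
  map_smul' c ρ := by simp

/-- `ρ ⊗ |0…0⟩⟨0…0|` on the register `ι ⊕ κ`. -/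
def tensorZeros {ι κ : Type} [Fintype κ] (ρ : QOp ι) : QOp (ι ⊕ κ) :=
  Matrix.of fun x y =>
    if (∀ j, x (Sum.inr j) = 0) ∧ (∀ j, y (Sum.inr j) = 0) then
      ρ (fun i => x (Sum.inl i)) (fun i => y (Sum.inl i))
    else 0

/-- The partial trace over the second register `κ`. -/
def traceOutRight {ι κ : Type} [Fintype κ] [DecidableEq κ] (σ : QOp (ι ⊕ κ)) : QOp ι :=
  Matrix.of fun x y => ∑ z : κ → Fin 2, σ (Sum.elim x z) (Sum.elim y z)

/-- The channel on the register `ι` implemented by an operator `W` on `ι ⊕ κ`: adjoin the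
qubits of `κ` in the state `|0…0⟩`, apply `W`, and discard the qubits of `κ`. -/
def ancillaChannel {ι κ : Type} [Fintype ι] [DecidableEq ι] [Fintype κ] [DecidableEq κ]
    (W : QOp (ι ⊕ κ)) : QOp ι →ₗ[ℂ] QOp ι where
  toFun ρ := traceOutRight (W * tensorZeros ρ * Wᴴ)
  map_add' ρ σ := by
    have h : (tensorZeros (ρ + σ) : QOp (ι ⊕ κ)) = tensorZeros ρ + tensorZeros σ := by
      ext x y
      simp only [tensorZeros, Matrix.of_apply, Matrix.add_apply]
      split_ifs <;> simp
    ext x y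
    simp [h, traceOutRight, Matrix.mul_add, Matrix.add_mul, Finset.sum_add_distrib]
  map_smul' c ρ := by
    have h : (tensorZeros (c • ρ) : QOp (ι ⊕ κ)) = c • tensorZeros ρ := by
      ext x y
      simp only [tensorZeros, Matrix.of_apply, Matrix.smul_apply]
      split_ifs <;> simp
    ext x y
    simp [h, traceOutRight, Finset.mul_sum]

/-- The map `E ⊗ id` on the system tensored with an `m`-dimensional reference system. -/
def tensorId {ι : Type} (m : ℕ) (E : QOp ι →ₗ[ℂ] QOp ι)
    (ρ : Matrix ((ι → Fin 2) × Fin m) ((ι → Fin 2) × Fin m) ℂ) :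
    Matrix ((ι → Fin 2) × Fin m) ((ι → Fin 2) × Fin m) ℂ :=
  Matrix.of fun p q => E (Matrix.of fun x y => ρ (x, p.2) (y, q.2)) p.1 q.1

/-- Density matrices. -/
def IsDensity {α : Type} [Fintype α] (ρ : Matrix α α ℂ) : Prop :=
  ρ.PosSemidef ∧ ρ.trace = 1

/-- The trace norm `Tr √(A† A)`, the sum of the singular values. -/
noncomputable def traceNorm {α : Type} [Fintype α] [DecidableEq α] (A : Matrix α α ℂ) : ℝ :=
  ∑ i, Real.sqrt ((Matrix.isHermitian_conjTranspose_mul_self A).eigenvalues i)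

/-- The diamond distance `sup_ρ ‖(E ⊗ id)(ρ) - (F ⊗ id)(ρ)‖₁` over all density matrices `ρ` of
the system together with a reference system of arbitrary finite dimension. -/
noncomputable def diamondDist {ι : Type} [Fintype ι] [DecidableEq ι]
    (E F : QOp ι →ₗ[ℂ] QOp ι) : ℝ≥0∞ :=
  ⨆ (m : ℕ) (ρ : Matrix ((ι → Fin 2) × Fin m) ((ι → Fin 2) × Fin m) ℂ) (_ : IsDensity ρ),
    ENNReal.ofReal (traceNorm (tensorId m E ρ - tensorId m F ρ))

/-! ### The randomized measurement dataset -/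

/-- The three Pauli bases. -/
inductive PauliAxis
  | X | Y | Z
  deriving DecidableEq

instance : Fintype PauliAxis :=
  ⟨{PauliAxis.X, PauliAxis.Y, PauliAxis.Z}, fun p => by cases p <;> simp⟩

instance : Nonempty PauliAxis := ⟨PauliAxis.X⟩

instance : MeasurableSpace PauliAxis := ⊤

instance : DiscreteMeasurableSpace PauliAxis := ⟨fun _ => trivial⟩

/-- Labels of the six single-qubit stabilizer states: an axis, and the sign of the eigenvalue
(`false` for `+1`, `true` for `-1`). -/
abbrev Stab : Type := PauliAxis × Bool

/-- The stabilizer states `|0⟩, |1⟩` (axis `Z`), `|±⟩` (axis `X`) and `|y±⟩` (axis `Y`). -/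
noncomputable def stabVec : Stab → Fin 2 → ℂ
  | (PauliAxis.Z, false) => ![1, 0]
  | (PauliAxis.Z, true) => ![0, 1]
  | (PauliAxis.X, false) => ![(1 / Real.sqrt 2 : ℝ), (1 / Real.sqrt 2 : ℝ)]
  | (PauliAxis.X, true) => ![(1 / Real.sqrt 2 : ℝ), -(1 / Real.sqrt 2 : ℝ)]
  | (PauliAxis.Y, false) => ![(1 / Real.sqrt 2 : ℝ), (1 / Real.sqrt 2 : ℝ) * Complex.I]
  | (PauliAxis.Y, true) => ![(1 / Real.sqrt 2 : ℝ), -((1 / Real.sqrt 2 : ℝ) * Complex.I)]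

/-- The product state with the given single-qubit stabilizer states. -/
noncomputable def prodState {n : ℕ} (a : Fin n → Stab) : (Fin n → Fin 2) → ℂ :=
  fun x => ∏ i, stabVec (a i) (x i)

/-- The outcome `s` of measuring each qubit `i` in the basis `b i` leaves this product state. -/
def collapsed {n : ℕ} (b : Fin n → PauliAxis) (s : Fin n → Bool) : Fin n → Stab :=
  fun i => (b i, s i)

/-- The Born probability `|⟨φ| U |ψ⟩|²`. -/
noncomputable def bornProb {n : ℕ} (U : QOp (Fin n)) (ψ φ : Fin n → Stab) : ℝ :=
  ‖star (prodState φ) ⬝ᵥ (U *ᵥ prodState ψ)‖ ^ 2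

theorem stabVec_complete (p : PauliAxis) (x y : Fin 2) :
    ∑ s, stabVec (p, s) x * star (stabVec (p, s) y) = if x = y then 1 else 0 := by
  have h : ((Real.sqrt 2 : ℝ) : ℂ)⁻¹ * ((Real.sqrt 2 : ℝ) : ℂ)⁻¹ = 1 / 2 := by
    rw [← mul_inv, ← Complex.ofReal_mul, Real.mul_self_sqrt (by norm_num)]
    norm_num
  cases p <;> fin_cases x <;> fin_cases y <;>
    simp [stabVec] <;> grind [Complex.I_sq]

theorem stabVec_norm (a : Stab) : ∑ x, star (stabVec a x) * stabVec a x = 1 := by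
  have h : ((Real.sqrt 2 : ℝ) : ℂ)⁻¹ * ((Real.sqrt 2 : ℝ) : ℂ)⁻¹ = 1 / 2 := by
    rw [← mul_inv, ← Complex.ofReal_mul, Real.mul_self_sqrt (by norm_num)]
    norm_num
  obtain ⟨p, s⟩ := a
  cases p <;> cases s <;> simp [stabVec] <;> grind [Complex.I_sq]

theorem prodState_norm {n : ℕ} (a : Fin n → Stab) : star (prodState a) ⬝ᵥ prodState a = 1 := by
  have h : star (prodState a) ⬝ᵥ prodState a =
      ∑ x : Fin n → Fin 2, ∏ i, star (stabVec (a i) (x i)) * stabVec (a i) (x i) := by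
    simp [dotProduct, prodState, Finset.prod_mul_distrib]
  rw [h, ← Fintype.prod_sum (fun i x => star (stabVec (a i) x) * stabVec (a i) x)]
  simp only [stabVec_norm, Finset.prod_const_one]

theorem prodState_complete {n : ℕ} (b : Fin n → PauliAxis) (x y : Fin n → Fin 2) :
    ∑ s, prodState (collapsed b s) x * star (prodState (collapsed b s) y) =
      if x = y then 1 else 0 := by
  have h : ∀ s, prodState (collapsed b s) x * star (prodState (collapsed b s) y) =
      ∏ i, stabVec (b i, s i) (x i) * star (stabVec (b i, s i) (y i)) := by
    intro s
    simp [prodState, collapsed, Finset.prod_mul_distrib]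
  simp only [h]
  rw [← Fintype.prod_sum (fun i s => stabVec (b i, s) (x i) * star (stabVec (b i, s) (y i)))]
  simp only [stabVec_complete]
  split_ifs with hxy
  · subst hxy
    simp
  · obtain ⟨i, hi⟩ := Function.ne_iff.1 hxy
    exact Finset.prod_eq_zero (Finset.mem_univ i) (by simp [hi])

theorem sum_bornProb {n : ℕ} (U : Matrix.unitaryGroup (Fin n → Fin 2) ℂ) (ψ : Fin n → Stab)
    (b : Fin n → PauliAxis) :
    ∑ s, bornProb (U : QOp (Fin n)) ψ (collapsed b s) = 1 := by
  set v : (Fin n → Fin 2) → ℂ := (U : QOp (Fin n)) *ᵥ prodState ψ with hv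
  have hnorm : star v ⬝ᵥ v = 1 := by
    have hU : (U : QOp (Fin n))ᴴ * (U : QOp (Fin n)) = 1 := Matrix.mem_unitaryGroup_iff'.1 U.2
    rw [hv, Matrix.star_mulVec, Matrix.dotProduct_mulVec, Matrix.vecMul_vecMul, hU,
      Matrix.vecMul_one, prodState_norm]
  have key : ∀ s, ((bornProb (U : QOp (Fin n)) ψ (collapsed b s) : ℝ) : ℂ) =
      ∑ x, ∑ y, star (v x) * v y *
        (prodState (collapsed b s) x * star (prodState (collapsed b s) y)) := by
    intro s
    rw [bornProb, ← hv, Complex.ofReal_pow, ← Complex.conj_mul', dotProduct, map_sum,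
      Finset.sum_mul_sum]
    refine Finset.sum_congr rfl fun x _ => Finset.sum_congr rfl fun y _ => ?_
    simp
    ring
  have hC : ((∑ s, bornProb (U : QOp (Fin n)) ψ (collapsed b s) : ℝ) : ℂ) = 1 := by
    rw [Complex.ofReal_sum, Finset.sum_congr rfl fun s _ => key s, Finset.sum_comm]
    rw [← hnorm, dotProduct]
    refine Finset.sum_congr rfl fun x _ => ?_
    rw [Finset.sum_comm]
    simp only [← Finset.mul_sum, prodState_complete]
    simp
  exact_mod_cast hC

/-- The distribution of the outcomes when the qubits of `U|ψ⟩` are measured in the bases `b`. -/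
noncomputable def outcomeLaw {n : ℕ} (U : Matrix.unitaryGroup (Fin n → Fin 2) ℂ)
    (ψ : Fin n → Stab) (b : Fin n → PauliAxis) : PMF (Fin n → Bool) :=
  PMF.ofFintype (fun s => ENNReal.ofReal (bornProb U ψ (collapsed b s))) (by
    rw [← ENNReal.ofReal_sum_of_nonneg (fun s _ => by unfold bornProb; positivity), sum_bornProb,
      ENNReal.ofReal_one])

/-- One data point: the labels of the input product state and of the collapsed product state. -/
abbrev Sample (n : ℕ) : Type := (Fin n → Stab) × (Fin n → Stab)

/-- The law of one data point: uniformly random stabilizer states on all qubits are prepared,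
`U` is applied, and each qubit is measured in a uniformly random Pauli basis. -/
noncomputable def sampleLaw {n : ℕ} (U : Matrix.unitaryGroup (Fin n → Fin 2) ℂ) :
    PMF (Sample n) :=
  (PMF.uniformOfFintype (Fin n → Stab)).bind fun ψ =>
    (PMF.uniformOfFintype (Fin n → PauliAxis)).bind fun b =>
      (outcomeLaw U ψ b).map fun s => (ψ, collapsed b s)

/-- The law of a randomized measurement dataset of size `N`: independent data points. -/
noncomputable def datasetLaw {n : ℕ} (U : Matrix.unitaryGroup (Fin n → Fin 2) ℂ) (N : ℕ) :
    Measure (Fin N → Sample n) :=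
  Measure.pi fun _ => (sampleLaw U).toMeasure

/-! The learner does a brute-force search: it outputs any circuit of depth at most `d` whose
predicted statistics fit the data, and ignores the ancillas, so `D = d`. What needs proof is that
fitting few-body statistics forces closeness in diamond distance.

The statistics (`testFn`) ask whether `K = 2 ^ (d + 1)` chosen inputs carry prescribed stabilizer
states, and multiply this by the signed outcome of one Pauli measurement on one output qubit. There
are only polynomially many in `n`, so Hoeffding and a union bound (`measureReal_isConsistent_ge`,
`failure_le`) make the true `U` consistent with its data with probability at least `1 - δ`. Hence a
candidate exists, and any candidate `V` has test means close to those of `U`.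

For every output qubit and Pauli `P`, the operators `U†PU` and `V†PV` live on light cones of at most
`2 ^ d` qubits each (`exists_actsOn_conj_circuit`). A test that fixes both light cones reads off the
expectations of these operators in product stabilizer states (`integral_testFn`). Such expectations
determine a `K`-body operator with constants depending only on `K`, so `U†PU` and `V†PV` are close
in norm (`norm_heisenberg_sub_le`).

Consequently `UV†` almost commutes with every one-qubit Pauli. Averaging over the `X` and `Z`
operators one at a time turns it into an exact scalar at a cost linear in `n`, so `U` is close to a
phase times `V` (`exists_phase_near`), which bounds the diamond distance
(`diamondDist_unitaryChannel_le`). The accuracy needed per test is of order `ε / n`, whence `n²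
log(n/δ) / ε²` samples. -/

/-! ### Operators supported on few qubits, and light cones. -/

section Locality

variable {ι : Type}

/-- `M` acts on the qubits in `A` only: `M = m ⊗ 1` for some operator `m` on the qubits of `A`.
The second condition is invariance under bit flips outside `A`. -/
structure ActsOn (A : Finset ι) (M : QOp ι) : Prop where
  eq_zero : ∀ x y i, i ∉ A → x i ≠ y i → M x y = 0
  shift : ∀ w : ι → Fin 2, (∀ i ∈ A, w i = 0) → ∀ x y, M (x + w) (y + w) = M x y

theorem ActsOn.mono {A B : Finset ι} {M : QOp ι} (h : ActsOn A M) (hAB : A ⊆ B) : ActsOn B M :=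
  ⟨fun x y i hi => h.eq_zero x y i fun hA => hi (hAB hA),
    fun w hw => h.shift w fun i hi => hw i (hAB hi)⟩

theorem ActsOn.conjTranspose {A : Finset ι} {M : QOp ι} (h : ActsOn A M) : ActsOn A Mᴴ :=
  ⟨fun x y i hi hxy => by
      rw [Matrix.conjTranspose_apply, h.eq_zero y x i hi hxy.symm, star_zero],
    fun w hw x y => by
      rw [Matrix.conjTranspose_apply, h.shift w hw, Matrix.conjTranspose_apply]⟩

theorem ActsOn.sub {A : Finset ι} {M N : QOp ι} (hM : ActsOn A M) (hN : ActsOn A N) :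
    ActsOn A (M - N) :=
  ⟨fun x y i hi hxy => by
      rw [Matrix.sub_apply, hM.eq_zero x y i hi hxy, hN.eq_zero x y i hi hxy, sub_zero],
    fun w hw x y => by rw [Matrix.sub_apply, hM.shift w hw, hN.shift w hw, Matrix.sub_apply]⟩

variable [Fintype ι] [DecidableEq ι]

theorem ActsOn.mul {A : Finset ι} {M N : QOp ι} (hM : ActsOn A M) (hN : ActsOn A N) :
    ActsOn A (M * N) := by
  refine ⟨fun x y i hi hxy => ?_, fun w hw x y => ?_⟩
  · rw [Matrix.mul_apply]
    refine Finset.sum_eq_zero fun z _ => ?_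
    by_cases hz : x i = z i
    · rw [hN.eq_zero z y i hi (hz ▸ hxy), mul_zero]
    · rw [hM.eq_zero x z i hi hz, zero_mul]
  · rw [Matrix.mul_apply, Matrix.mul_apply, ← Equiv.sum_comp (Equiv.addRight w)]
    exact Finset.sum_congr rfl fun z _ => by
      rw [Equiv.coe_addRight, hM.shift w hw, hN.shift w hw]

/-- If `z` is the intermediate string in an entry of `N * M`, the corresponding one for `M * N` is
`x + y - z`: the roles of `x` and `y` are exchanged. Reindexing by this involution matches the two
sums term by term, and the shift invariance identifies the factors. -/
theorem ActsOn.commute {A B : Finset ι} {M N : QOp ι} (hM : ActsOn A M) (hN : ActsOn B N)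
    (hAB : Disjoint A B) : Commute M N := by
  ext x y
  rw [Matrix.mul_apply, Matrix.mul_apply, ← Equiv.sum_comp (Equiv.subLeft (x + y))]
  refine Finset.sum_congr rfl fun z _ => ?_
  rw [Equiv.subLeft_apply]
  by_cases hx : ∀ i ∉ A, x i = (x + y - z) i
  · by_cases hy : ∀ i ∉ B, (x + y - z) i = y i
    · have hx' : ∀ i ∉ A, z i = y i := fun i hi => by
        have := hx i hi
        simp only [Pi.add_apply, Pi.sub_apply] at this
        rw [add_sub_assoc, left_eq_add, sub_eq_zero] at this
        exact this.symm
      have hy' : ∀ i ∉ B, x i = z i := fun i hi => by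
        have := hy i hi
        simp only [Pi.add_apply, Pi.sub_apply] at this
        rw [add_sub_right_comm, add_eq_right, sub_eq_zero] at this
        exact this
      have h1 := hM.shift (x - z) (fun i hi => by
        simp [hy' i (Finset.disjoint_left.1 hAB hi)]) z y
      have h2 := hN.shift (y - z) (fun i hi => by
        simp [hx' i (Finset.disjoint_right.1 hAB hi)]) x z
      rw [show z + (x - z) = x by abel, show y + (x - z) = x + y - z by abel] at h1
      rw [show z + (y - z) = y by abel, show x + (y - z) = x + y - z by abel] at h2
      rw [h2, ← h1, mul_comm]
    · push Not at hy
      obtain ⟨i, hi, h⟩ := hy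
      rw [hN.eq_zero _ _ i hi h, hN.eq_zero x z i hi, mul_zero, zero_mul]
      intro hxz
      apply h
      simp [hxz]
  · push Not at hx
    obtain ⟨i, hi, h⟩ := hx
    rw [hM.eq_zero _ _ i hi h, hM.eq_zero z y i hi, mul_zero, zero_mul]
    intro hxz
    apply h
    simp [hxz]

/-- The product operator `⨂ m i`. -/
def prodOp (m : ι → Matrix (Fin 2) (Fin 2) ℂ) : QOp ι :=
  Matrix.of fun x y => ∏ i, m i (x i) (y i)

theorem prodOp_mul (m m' : ι → Matrix (Fin 2) (Fin 2) ℂ) :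
    prodOp m * prodOp m' = prodOp (m * m') := by
  ext x y
  simp only [prodOp, Matrix.mul_apply, Matrix.of_apply, Pi.mul_apply, ← Finset.prod_mul_distrib]
  exact (Fintype.prod_sum fun i z => m i (x i) z * m' i z (y i)).symm

omit [DecidableEq ι] in
theorem prodOp_conjTranspose (m : ι → Matrix (Fin 2) (Fin 2) ℂ) :
    (prodOp m)ᴴ = prodOp fun i => (m i)ᴴ := by
  ext x y
  simp [prodOp, Matrix.conjTranspose_apply]

omit [DecidableEq ι] in
theorem prodOp_one : prodOp (1 : ι → Matrix (Fin 2) (Fin 2) ℂ) = 1 := by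
  ext x y
  simp only [prodOp, Matrix.of_apply, Pi.one_apply, Matrix.one_apply]
  split_ifs with h
  · simp [h]
  · obtain ⟨i, hi⟩ := Function.ne_iff.1 h
    exact Finset.prod_eq_zero (Finset.mem_univ i) (if_neg hi)

theorem actsOn_prodOp {A : Finset ι} {m : ι → Matrix (Fin 2) (Fin 2) ℂ}
    (h : ∀ i ∉ A, m i = 1) : ActsOn A (prodOp m) := by
  refine ⟨fun x y i hi hxy => ?_, fun w hw x y => ?_⟩
  · exact Finset.prod_eq_zero (Finset.mem_univ i) (by simp [h i hi, hxy])
  · refine Finset.prod_congr rfl fun i _ => ?_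
    by_cases hi : i ∈ A
    · simp [hw i hi]
    · simp [h i hi, Matrix.one_apply]

theorem QGate.actsOn_toOp (g : QGate ι) : ActsOn g.supp g.toOp := by
  refine ⟨fun x y i hi hxy => ?_, fun w hw x y => ?_⟩
  · simp only [QGate.toOp, Matrix.of_apply]
    exact if_neg fun h => hxy (h i hi)
  · simp only [QGate.toOp, Matrix.of_apply, Pi.add_apply, add_left_inj]
    have h : ∀ x : ι → Fin 2, (fun i : g.supp => x i + w i) = fun i : g.supp => x i := fun x => by
      funext i
      simp [hw i i.2]
    rw [h, h]

theorem QGate.toOp_unitary (g : QGate ι) : g.toOpᴴ * g.toOp = 1 := by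
  have hmat := Matrix.mem_unitaryGroup_iff'.1 g.mat.2
  ext x y
  rw [Matrix.mul_apply]
  simp only [Matrix.conjTranspose_apply, QGate.toOp, Matrix.of_apply]
  by_cases hxy : ∀ i ∉ g.supp, x i = y i
  · have h1 : (1 : QOp ι) x y =
        (1 : Matrix (g.supp → Fin 2) (g.supp → Fin 2) ℂ) (fun i => x i) (fun i => y i) := by
      simp only [Matrix.one_apply]
      congr 1
      rw [eq_iff_iff, funext_iff, funext_iff]
      refine ⟨fun h i => h i, fun h i => ?_⟩
      by_cases hi : i ∈ g.supp
      · exact h ⟨i, hi⟩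
      · exact hxy i hi
    rw [h1, ← hmat, Matrix.mul_apply]
    symm
    -- Only intermediate strings agreeing with `x` off the support contribute; they are parametrized
    -- by their bits on the support.
    refine Finset.sum_of_injOn (fun z i => if h : i ∈ g.supp then z ⟨i, h⟩ else x i) ?_ ?_ ?_ ?_
    · intro z _ z' _ h
      funext i
      simpa using congrFun h i
    · simp
    · intro z _ hz
      rw [if_neg, star_zero, zero_mul]
      intro h
      apply hz
      refine ⟨fun i => z i, by simp, ?_⟩
      funext i
      by_cases hi : i ∈ g.supp <;> simp [hi, h]
    · intro z _
      have e1 : ∀ i ∉ g.supp, (if h : i ∈ g.supp then z ⟨i, h⟩ else x i) = x i :=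
        fun i hi => dif_neg hi
      have e2 : ∀ i ∉ g.supp, (if h : i ∈ g.supp then z ⟨i, h⟩ else x i) = y i :=
        fun i hi => (dif_neg hi).trans (hxy i hi)
      rw [if_pos e1, if_pos e2]
      simp [Matrix.star_apply]
  · have hne : x ≠ y := fun h => hxy fun i _ => by rw [h]
    rw [Matrix.one_apply_ne hne]
    refine Finset.sum_eq_zero fun z _ => ?_
    by_cases hz : ∀ i ∉ g.supp, z i = x i
    · rw [if_neg (c := ∀ i ∉ g.supp, z i = y i), mul_zero]
      exact fun h => hxy fun i hi => (hz i hi).symm.trans (h i hi)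
    · rw [if_neg hz, star_zero, zero_mul]

/-- Conjugating by parallel gates: the qubits in `A` may each be spread by one gate, those in `B`
are not touched by the gates. -/
theorem exists_actsOn_conj_gates (l : List (QGate ι))
    (hl : l.Pairwise fun g h => Disjoint g.supp h.supp) (A B : Finset ι)
    (hB : ∀ g ∈ l, Disjoint g.supp B) (M : QOp ι) (hM : ActsOn (A ∪ B) M) :
    ∃ S : Finset ι, S.card ≤ 2 * A.card + B.card ∧
      ActsOn S ((l.map QGate.toOp).prodᴴ * M * (l.map QGate.toOp).prod) := by
  induction l generalizing A B M with
  | nil =>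
    refine ⟨A ∪ B, (Finset.card_union_le A B).trans (by omega), by simpa using hM⟩
  | cons g l ih =>
    rw [List.pairwise_cons] at hl
    have hrw : ((g :: l).map QGate.toOp).prodᴴ * M * ((g :: l).map QGate.toOp).prod =
        (l.map QGate.toOp).prodᴴ * (g.toOpᴴ * M * g.toOp) * (l.map QGate.toOp).prod := by
      simp [Matrix.mul_assoc]
    rw [hrw]
    by_cases hg : Disjoint (A ∪ B) g.supp
    · have hc : g.toOpᴴ * M * g.toOp = M := by
        rw [Matrix.mul_assoc, (hM.commute g.actsOn_toOp hg).eq, ← Matrix.mul_assoc,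
          g.toOp_unitary, Matrix.one_mul]
      rw [hc]
      exact ih hl.2 A B (fun h hh => hB h (List.mem_cons_of_mem _ hh)) M hM
    -- The gate avoids `B`, so it must meet `A`: at least one qubit leaves `A` and at most two enter
    -- `B`, and `2|A| + |B|` does not grow.
    · have hsub : (A ∪ B) ⊆ (A \ g.supp) ∪ (B ∪ g.supp) := by
        intro i hi
        by_cases h : i ∈ g.supp <;> simp [h] at hi ⊢
        exact hi
      have hsub' : g.supp ⊆ (A \ g.supp) ∪ (B ∪ g.supp) := fun i hi => by simp [hi]
      obtain ⟨S, hS, hact⟩ := ih hl.2 (A \ g.supp) (B ∪ g.supp) (fun h hh => by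
          rw [Finset.disjoint_union_right]
          exact ⟨hB h (List.mem_cons_of_mem _ hh), (hl.1 h hh).symm⟩) (g.toOpᴴ * M * g.toOp)
        (((g.actsOn_toOp.mono hsub').conjTranspose.mul (hM.mono hsub)).mul
          (g.actsOn_toOp.mono hsub'))
      refine ⟨S, hS.trans ?_, hact⟩
      have h1 : (B ∪ g.supp).card ≤ B.card + g.supp.card := Finset.card_union_le _ _
      have h2 : g.supp.card ≤ 2 := by have := g.supp_card; omega
      have h3 : (A \ g.supp).card + (A ∩ g.supp).card = A.card := Finset.card_sdiff_add_card_inter _ _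
      have h4 : 0 < (A ∩ g.supp).card := by
        rw [Finset.card_pos, ← Finset.not_disjoint_iff_nonempty_inter]
        intro hA
        exact hg (Finset.disjoint_union_left.2 ⟨hA, (hB g List.mem_cons_self).symm⟩)
      omega

/-- The light cone of a shallow circuit. -/
theorem exists_actsOn_conj_circuit (c : QCircuit ι) (A : Finset ι) (M : QOp ι)
    (hM : ActsOn A M) :
    ∃ S : Finset ι, S.card ≤ 2 ^ QCircuit.depth c * A.card ∧
      ActsOn S ((QCircuit.toOp c)ᴴ * M * QCircuit.toOp c) := by
  induction c with
  | nil => exact ⟨A, by simp [QCircuit.depth], by simpa [QCircuit.toOp] using hM⟩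
  | cons L c ih =>
    obtain ⟨S, hS, hact⟩ := ih
    -- Each layer starts with no spread qubits, so it at most doubles the support.
    obtain ⟨S', hS', hact'⟩ := exists_actsOn_conj_gates L.gates L.disjoint S ∅ (by simp)
      _ (by simpa using hact)
    refine ⟨S', hS'.trans ?_, ?_⟩
    · have : QCircuit.depth (L :: c) = QCircuit.depth c + 1 := rfl
      rw [this, pow_succ]
      simp only [Finset.card_empty]
      linarith
    · have : QCircuit.toOp (L :: c) = QCircuit.toOp c * (L.gates.map QGate.toOp).prod := by
        simp [QCircuit.toOp, QLayer.toOp]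
      rw [this]
      simpa only [Matrix.conjTranspose_mul, Matrix.mul_assoc] using hact'

end Locality

/-! ### A bound on the operator norm by row and column sums. -/

section SchurTest

open scoped Matrix.Norms.L2Operator

/-- Schur's test with constant weights. -/
theorem l2_opNorm_le_of_sum_le {α : Type} [Fintype α] [DecidableEq α] (M : Matrix α α ℂ) {R : ℝ}
    (hR : 0 ≤ R) (hrow : ∀ x, ∑ y, ‖M x y‖ ≤ R) (hcol : ∀ y, ∑ x, ‖M x y‖ ≤ R) : ‖M‖ ≤ R := by
  rw [Matrix.cstar_norm_def]
  refine ContinuousLinearMap.opNorm_le_bound _ hR fun v => ?_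
  refine le_of_sq_le_sq ?_ (by positivity)
  rw [mul_pow, EuclideanSpace.norm_sq_eq, EuclideanSpace.norm_sq_eq]
  have hx : ∀ x, ‖(Matrix.toEuclideanCLM (n := α) (𝕜 := ℂ) M v) x‖ ^ 2 ≤
      R * ∑ y, ‖M x y‖ * ‖v y‖ ^ 2 := by
    intro x
    rw [Matrix.ofLp_toEuclideanCLM, Matrix.mulVec, dotProduct]
    calc ‖∑ y, M x y * v y‖ ^ 2 ≤ (∑ y, ‖M x y‖ * ‖v y‖) ^ 2 := by
          gcongr
          exact (norm_sum_le _ _).trans_eq (by simp)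
      _ ≤ (∑ y, ‖M x y‖) * ∑ y, ‖M x y‖ * ‖v y‖ ^ 2 :=
          Finset.sum_sq_le_sum_mul_sum_of_sq_le_mul _ (fun _ _ => by positivity)
            (fun _ _ => by positivity) (fun _ _ => by ring_nf; rfl)
      _ ≤ R * ∑ y, ‖M x y‖ * ‖v y‖ ^ 2 := by
          gcongr
          exact hrow x
  calc _ ≤ ∑ x, R * ∑ y, ‖M x y‖ * ‖v y‖ ^ 2 := Finset.sum_le_sum fun x _ => hx x
    _ = R * ∑ y, (∑ x, ‖M x y‖) * ‖v y‖ ^ 2 := by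
        rw [← Finset.mul_sum, Finset.sum_comm]
        simp only [Finset.sum_mul]
    _ ≤ R * ∑ y, R * ‖v y‖ ^ 2 := by
        gcongr with y
        exact hcol y
    _ = R ^ 2 * ∑ y, ‖v y‖ ^ 2 := by
        rw [← Finset.mul_sum]
        ring

end SchurTest

/-! ### Recovering a local operator from its expectations in product stabilizer states. -/

section StabilizerExpectations

/-- The Pauli matrices, as differences of the projections onto the stabilizer states. -/
noncomputable def sigma (P : PauliAxis) : Matrix (Fin 2) (Fin 2) ℂ :=
  Matrix.of fun x y => ∑ s : Bool,
    (if s then -1 else 1) * (stabVec (P, s) x * star (stabVec (P, s) y))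

/-- The Pauli operator `P` on the qubit `i`. -/
noncomputable def pauliOp {ι : Type} [Fintype ι] [DecidableEq ι] (i : ι) (P : PauliAxis) :
    QOp ι :=
  prodOp (Function.update 1 i (sigma P))

/-- The expectation of `M` in a product of stabilizer states. -/
noncomputable def stabExp {n : ℕ} (M : QOp (Fin n)) (a : Fin n → Stab) : ℂ :=
  star (prodState a) ⬝ᵥ (M *ᵥ prodState a)

variable {n : ℕ}

theorem stabExp_eq_sum (M : QOp (Fin n)) (a : Fin n → Stab) :
    stabExp M a = ∑ x, ∑ y, M x y * ∏ j, (star (stabVec (a j) (x j)) * stabVec (a j) (y j)) := by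
  simp only [stabExp, dotProduct, Matrix.mulVec, Finset.mul_sum]
  refine Finset.sum_congr rfl fun x _ => Finset.sum_congr rfl fun y _ => ?_
  rw [Finset.prod_mul_distrib]
  simp only [prodState, Pi.star_apply, star_prod]
  ring

theorem stabExp_sub (M N : QOp (Fin n)) (a : Fin n → Stab) :
    stabExp (M - N) a = stabExp M a - stabExp N a := by
  simp [stabExp, Matrix.sub_mulVec]

theorem prodOp_mulVec_prodState (m : Fin n → Matrix (Fin 2) (Fin 2) ℂ) (a a' : Fin n → Stab)
    (h : ∀ i, m i *ᵥ stabVec (a i) = stabVec (a' i)) :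
    prodOp m *ᵥ prodState a = prodState a' := by
  ext x
  simp only [Matrix.mulVec, dotProduct, prodOp, Matrix.of_apply, prodState,
    ← Finset.prod_mul_distrib, ← h]
  exact (Fintype.prod_sum fun i z => m i (x i) z * stabVec (a i) z).symm

/-- The product of the rank-one operators `|a' i⟩⟨a i|` over the qubits outside `S` carries one
state to the other, its adjoint carries it back, and it commutes with `M`. -/
theorem stabExp_congr {S : Finset (Fin n)} {M : QOp (Fin n)} (hM : ActsOn S M)
    {a a' : Fin n → Stab} (h : ∀ i ∈ S, a i = a' i) : stabExp M a = stabExp M a' := by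
  set m : Fin n → Matrix (Fin 2) (Fin 2) ℂ := fun i =>
    if i ∈ S then 1 else Matrix.vecMulVec (stabVec (a' i)) (star (stabVec (a i))) with hm
  have hnorm : ∀ b : Stab, star (stabVec b) ⬝ᵥ stabVec b = 1 := fun b => by
    simpa [dotProduct] using stabVec_norm b
  have h1 : prodOp m *ᵥ prodState a = prodState a' := prodOp_mulVec_prodState _ _ _ fun i => by
    by_cases hi : i ∈ S
    · simp [hm, hi, h i hi]
    · simp [hm, hi, Matrix.vecMulVec_mulVec, hnorm]
  have h2 : (prodOp m)ᴴ *ᵥ prodState a' = prodState a := by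
    rw [prodOp_conjTranspose]
    refine prodOp_mulVec_prodState _ _ _ fun i => ?_
    by_cases hi : i ∈ S
    · simp [hm, hi, h i hi]
    · simp [hm, hi, Matrix.conjTranspose_vecMulVec, Matrix.vecMulVec_mulVec, hnorm]
  have hact : ActsOn Sᶜ (prodOp m) := actsOn_prodOp fun i hi => by
    rw [Finset.mem_compl, not_not] at hi
    simp [hm, hi]
  have hc := hact.conjTranspose.commute hM disjoint_compl_left
  symm
  calc stabExp M a' = star (prodOp m *ᵥ prodState a) ⬝ᵥ (M *ᵥ (prodOp m *ᵥ prodState a)) := by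
        rw [h1, stabExp]
    _ = star (prodState a) ⬝ᵥ (((prodOp m)ᴴ * M) *ᵥ (prodOp m *ᵥ prodState a)) := by
        rw [Matrix.star_mulVec, ← Matrix.dotProduct_mulVec, Matrix.mulVec_mulVec _ _ M,
          Matrix.mulVec_mulVec]
    _ = stabExp M a := by
        rw [hc.eq, ← Matrix.mulVec_mulVec, h1, h2, stabExp]

theorem sum_pauliAxis {β : Type*} [AddCommMonoid β] (f : PauliAxis → β) :
    ∑ p, f p = f PauliAxis.X + f PauliAxis.Y + f PauliAxis.Z := by
  have h : (Finset.univ : Finset PauliAxis) = {PauliAxis.X, PauliAxis.Y, PauliAxis.Z} := rfl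
  rw [h, Finset.sum_insert (by simp), Finset.sum_insert (by simp), Finset.sum_singleton, add_assoc]

theorem inv_sqrt_two_mul_self :
    ((Real.sqrt 2 : ℝ) : ℂ)⁻¹ * ((Real.sqrt 2 : ℝ) : ℂ)⁻¹ = 1 / 2 := by
  rw [← mul_inv, ← Complex.ofReal_mul, Real.mul_self_sqrt (by norm_num)]
  norm_num

/-- The matrix units are combinations of the projections onto the stabilizer states. -/
theorem exists_matrixUnit_coeff (x y : Fin 2) : ∃ c : Stab → ℂ,
    (∀ x' y', ∑ a, c a * (star (stabVec a x') * stabVec a y') =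
      if x' = x ∧ y' = y then 1 else 0) ∧
    ∑ a, ‖c a‖ ≤ if x = y then 1 else 2 := by
  have h := inv_sqrt_two_mul_self
  -- Diagonal units are single projections; off-diagonal ones are `(X ± iY) / 2`, with four
  -- coefficients of modulus `1 / 2`. The sharp bound `1` on the diagonal later prevents a factor
  -- exponential in `n`.
  let c : Fin 2 → Fin 2 → Stab → ℂ := fun x y a =>
    match x, y, a with
    | 0, 0, (PauliAxis.Z, false) => 1
    | 1, 1, (PauliAxis.Z, true) => 1
    | 0, 1, (PauliAxis.X, false) => 1 / 2
    | 0, 1, (PauliAxis.X, true) => -1 / 2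
    | 0, 1, (PauliAxis.Y, false) => -Complex.I / 2
    | 0, 1, (PauliAxis.Y, true) => Complex.I / 2
    | 1, 0, (PauliAxis.X, false) => 1 / 2
    | 1, 0, (PauliAxis.X, true) => -1 / 2
    | 1, 0, (PauliAxis.Y, false) => Complex.I / 2
    | 1, 0, (PauliAxis.Y, true) => -Complex.I / 2
    | _, _, _ => 0
  refine ⟨c x y, fun x' y' => ?_, ?_⟩
  · rw [Fintype.sum_prod_type, sum_pauliAxis]
    fin_cases x <;> fin_cases y <;> fin_cases x' <;> fin_cases y' <;>
      simp [c, stabVec] <;> grind [Complex.I_sq]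
  · rw [Fintype.sum_prod_type, sum_pauliAxis]
    fin_cases x <;> fin_cases y <;> simp [c] <;> norm_num

/-- A few-body operator is controlled by its expectations in products of stabilizer states. -/
theorem ActsOn.norm_apply_le {S : Finset (Fin n)} {M : QOp (Fin n)} (hM : ActsOn S M) {G : ℝ}
    (hG : ∀ a, ‖stabExp M a‖ ≤ G) (x y : Fin n → Fin 2) : ‖M x y‖ ≤ 2 ^ S.card * G := by
  have hG0 : 0 ≤ G := (norm_nonneg _).trans (hG fun _ => (PauliAxis.X, false))
  by_cases hxy : ∀ i ∉ S, x i = y i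
  · choose c hc hc' using exists_matrixUnit_coeff
    have key : M x y = ∑ a : Fin n → Stab, (∏ j, c (x j) (y j) (a j)) * stabExp M a := by
      simp only [stabExp_eq_sum, Finset.mul_sum]
      rw [Finset.sum_comm]
      have hin : ∀ x' : Fin n → Fin 2, ∀ y' : Fin n → Fin 2,
          ∑ a : Fin n → Stab, (∏ j, c (x j) (y j) (a j)) *
            (M x' y' * ∏ j, (star (stabVec (a j) (x' j)) * stabVec (a j) (y' j))) =
          if x' = x then if y' = y then M x' y' else 0 else 0 := by
        intro x' y'
        have h1 : ∀ a : Fin n → Stab, (∏ j, c (x j) (y j) (a j)) *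
            (M x' y' * ∏ j, (star (stabVec (a j) (x' j)) * stabVec (a j) (y' j))) =
            M x' y' * ∏ j, (c (x j) (y j) (a j) *
              (star (stabVec (a j) (x' j)) * stabVec (a j) (y' j))) := fun a => by
          rw [Finset.prod_mul_distrib (f := fun j => c (x j) (y j) (a j))]
          ring
        simp only [h1, ← Finset.mul_sum]
        rw [← Fintype.prod_sum fun j b => c (x j) (y j) b *
          (star (stabVec b (x' j)) * stabVec b (y' j))]
        simp only [hc]
        by_cases hx : x' = x
        · by_cases hy : y' = y
          · simp [hx, hy]
          · obtain ⟨j, hj⟩ := Function.ne_iff.1 hy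
            rw [Finset.prod_eq_zero (Finset.mem_univ j) (by simp [hj])]
            simp [hy]
        · obtain ⟨j, hj⟩ := Function.ne_iff.1 hx
          rw [Finset.prod_eq_zero (Finset.mem_univ j) (by simp [hj])]
          simp [hx]
      symm
      calc _ = ∑ x', ∑ y', ∑ a : Fin n → Stab, (∏ j, c (x j) (y j) (a j)) *
            (M x' y' * ∏ j, (star (stabVec (a j) (x' j)) * stabVec (a j) (y' j))) :=
            Finset.sum_congr rfl fun x' _ => Finset.sum_comm
        _ = M x y := by simp only [hin]; simp
    calc ‖M x y‖ ≤ ∑ a : Fin n → Stab, ‖(∏ j, c (x j) (y j) (a j)) * stabExp M a‖ := by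
          rw [key]
          exact norm_sum_le _ _
      _ ≤ ∑ a : Fin n → Stab, (∏ j, ‖c (x j) (y j) (a j)‖) * G := by
          gcongr with a
          rw [norm_mul, norm_prod]
          gcongr
          exact hG a
      _ = (∏ j, ∑ b, ‖c (x j) (y j) b‖) * G := by
          rw [← Finset.sum_mul, Fintype.prod_sum]
      -- Off `S` the strings agree, so only diagonal units occur there, each with weight at most
      -- `1`.
      _ ≤ (∏ j, if j ∈ S then 2 else 1) * G := by
          gcongr with j
          refine (hc' _ _).trans ?_
          by_cases hj : j ∈ S
          · rw [if_pos hj]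
            split_ifs <;> norm_num
          · rw [if_neg hj, if_pos (hxy j hj)]
      _ = 2 ^ S.card * G := by
          simp
  · push Not at hxy
    obtain ⟨i, hi, h⟩ := hxy
    rw [hM.eq_zero x y i hi h, norm_zero]
    positivity

theorem card_eq_off_le (S : Finset (Fin n)) (x : Fin n → Fin 2) :
    (Finset.univ.filter fun y : Fin n → Fin 2 => ∀ i ∉ S, x i = y i).card ≤ 2 ^ S.card := by
  have h : (Finset.univ.filter fun y : Fin n → Fin 2 => ∀ i ∉ S, x i = y i) ⊆
      Fintype.piFinset fun i => if i ∈ S then Finset.univ else {x i} := by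
    intro y hy
    rw [Finset.mem_filter] at hy
    rw [Fintype.mem_piFinset]
    intro i
    by_cases hi : i ∈ S
    · simp [hi]
    · simp [hi, hy.2 i hi]
  refine (Finset.card_le_card h).trans_eq ?_
  rw [Fintype.card_piFinset]
  simp only [apply_ite Finset.card, Finset.card_univ, Fintype.card_fin, Finset.card_singleton]
  simp

open scoped Matrix.Norms.L2Operator in
-- Every row and column has at most `2 ^ S.card` nonzero entries, each at most `2 ^ S.card * G`;
-- Schur's test multiplies the two.
theorem ActsOn.norm_le {S : Finset (Fin n)} {M : QOp (Fin n)} (hM : ActsOn S M) {G : ℝ}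
    (hG : ∀ a, ‖stabExp M a‖ ≤ G) : ‖M‖ ≤ 4 ^ S.card * G := by
  have hG0 : 0 ≤ G := (norm_nonneg _).trans (hG fun _ => (PauliAxis.X, false))
  have hsum : ∀ (f : (Fin n → Fin 2) → ℝ) (x : Fin n → Fin 2),
      (∀ y, f y ≤ 2 ^ S.card * G) → (∀ y, ¬ (∀ i ∉ S, x i = y i) → f y = 0) →
      ∑ y, f y ≤ 4 ^ S.card * G := by
    intro f x hf hf0
    rw [← Finset.sum_filter_of_ne (p := fun y => ∀ i ∉ S, x i = y i)
      (fun y _ hy => by_contra fun h => hy (hf0 y h))]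
    refine (Finset.sum_le_card_nsmul _ _ _ fun y _ => hf y).trans ?_
    rw [nsmul_eq_mul, ← mul_assoc, show (4 : ℝ) = 2 * 2 by norm_num, mul_pow]
    gcongr
    exact_mod_cast card_eq_off_le S x
  refine l2_opNorm_le_of_sum_le M (by positivity) (fun x => ?_) (fun y => ?_)
  · refine hsum _ x (fun y => hM.norm_apply_le hG x y) fun y hy => ?_
    push Not at hy
    obtain ⟨i, hi, h⟩ := hy
    rw [hM.eq_zero x y i hi h, norm_zero]
  · refine hsum _ y (fun x => hM.norm_apply_le hG x y) fun x hx => ?_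
    push Not at hx
    obtain ⟨i, hi, h⟩ := hx
    rw [hM.eq_zero x y i hi h.symm, norm_zero]

end StabilizerExpectations

/-! ### From almost commuting with Paulis to being close to a scalar. -/

section Twirl

open scoped Matrix.Norms.L2Operator

theorem l2_opNorm_le_one {α : Type} [Fintype α] [DecidableEq α] {U : Matrix α α ℂ}
    (h : Uᴴ * U = 1) : ‖U‖ ≤ 1 := by
  have h1 : ‖(1 : Matrix α α ℂ)‖ ≤ 1 := by
    rw [← Matrix.diagonal_one, Matrix.l2_opNorm_diagonal]
    exact (pi_norm_le_iff_of_nonneg zero_le_one).2 fun i => by simp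
  have h2 := Matrix.l2_opNorm_conjTranspose_mul_self U
  rw [h] at h2
  nlinarith [norm_nonneg U]

/-- Averaging successively over involutions that commute or anticommute with each other: an
operator that almost commutes with all of them is close to one that commutes with all of them. -/
theorem exists_commute_of_almost_commute {α : Type} [Fintype α] [DecidableEq α]
    (l : List (Matrix α α ℂ)) (hl : ∀ P ∈ l, P * P = 1 ∧ ‖P‖ ≤ 1)
    (hac : ∀ P ∈ l, ∀ P' ∈ l, P * P' = P' * P ∨ P * P' = -(P' * P)) (Q : Matrix α α ℂ) {e : ℝ}
    (hQ : ∀ P ∈ l, ‖P * Q - Q * P‖ ≤ e) :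
    ∃ M, (∀ P ∈ l, P * M = M * P) ∧ ‖M - Q‖ ≤ l.length * (e / 2) := by
  induction l with
  | nil => exact ⟨Q, by simp, by simp⟩
  | cons P l ih =>
    obtain ⟨M, hM, hMQ⟩ := ih (fun P hP => hl P (List.mem_cons_of_mem _ hP))
      (fun P hP P' hP' => hac P (List.mem_cons_of_mem _ hP) P' (List.mem_cons_of_mem _ hP'))
      (fun P hP => hQ P (List.mem_cons_of_mem _ hP))
    obtain ⟨hPP, hPn⟩ := hl P List.mem_cons_self
    have hconj : ∀ N : Matrix α α ℂ, ‖P * N * P‖ ≤ ‖N‖ := fun N => by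
      calc ‖P * N * P‖ ≤ ‖P‖ * ‖N‖ * ‖P‖ := (norm_mul_le _ _).trans (by gcongr; exact norm_mul_le _ _)
        _ ≤ 1 * ‖N‖ * 1 := by gcongr
        _ = ‖N‖ := by ring
    -- The average commutes with `P` because `P² = 1`. It still commutes with each earlier `P'`,
    -- since a sign from anticommutation appears twice.
    refine ⟨(1 / 2 : ℂ) • (M + P * M * P), fun P' hP' => ?_, ?_⟩
    · rw [Matrix.mul_smul, Matrix.smul_mul, Matrix.mul_add, Matrix.add_mul]
      congr 1
      rcases List.mem_cons.1 hP' with rfl | hP'l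
      · rw [Matrix.mul_assoc P' M P', ← Matrix.mul_assoc P' P', hPP, Matrix.one_mul,
          Matrix.mul_assoc P' (M * P'), Matrix.mul_assoc M, hPP, Matrix.mul_one, add_comm]
      · have hM' := hM P' hP'l
        have : P' * (P * M * P) = P * M * P * P' := by
          rcases hac P' hP' P List.mem_cons_self with h | h
          · calc P' * (P * M * P) = (P' * P) * M * P := by simp only [Matrix.mul_assoc]
              _ = P * (P' * M) * P := by rw [h]; simp only [Matrix.mul_assoc]
              _ = P * M * (P' * P) := by rw [hM']; simp only [Matrix.mul_assoc]
              _ = P * M * P * P' := by rw [h]; simp only [Matrix.mul_assoc]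
          · calc P' * (P * M * P) = (P' * P) * M * P := by simp only [Matrix.mul_assoc]
              _ = -(P * (P' * M) * P) := by
                rw [h]; simp only [Matrix.mul_assoc, Matrix.neg_mul]
              _ = -(P * M * (P' * P)) := by rw [hM']; simp only [Matrix.mul_assoc]
              _ = P * M * P * P' := by
                rw [h]; simp only [Matrix.mul_assoc, Matrix.mul_neg, neg_neg]
        rw [hM', this]
    · have hdecomp : (1 / 2 : ℂ) • (M + P * M * P) - Q =
          (1 / 2 : ℂ) • ((M - Q) + P * (M - Q) * P) + (1 / 2 : ℂ) • ((P * Q - Q * P) * P) := by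
        have : (P * Q - Q * P) * P = P * Q * P - Q := by
          rw [Matrix.sub_mul, Matrix.mul_assoc Q, hPP, Matrix.mul_one]
        rw [this, Matrix.mul_sub, Matrix.sub_mul]
        module
      rw [hdecomp]
      have h1 : ‖(M - Q) + P * (M - Q) * P‖ ≤ 2 * ‖M - Q‖ :=
        (norm_add_le _ _).trans (by linarith [hconj (M - Q)])
      have h2 : ‖(P * Q - Q * P) * P‖ ≤ e := by
        refine (norm_mul_le _ _).trans ?_
        have := hQ P List.mem_cons_self
        nlinarith [norm_nonneg (P * Q - Q * P)]
      refine (norm_add_le _ _).trans ?_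
      rw [norm_smul, norm_smul]
      have h3 : ‖(1 / 2 : ℂ)‖ = 1 / 2 := by norm_num
      rw [h3, List.length_cons]
      push_cast
      linarith

theorem sigma_X : sigma PauliAxis.X = !![0, 1; 1, 0] := by
  have h := inv_sqrt_two_mul_self
  ext x y
  fin_cases x <;> fin_cases y <;> simp [sigma, stabVec] <;> grind

theorem sigma_Z : sigma PauliAxis.Z = !![1, 0; 0, -1] := by
  ext x y
  fin_cases x <;> fin_cases y <;> simp [sigma, stabVec]

variable {ι : Type} [Fintype ι] [DecidableEq ι]

theorem actsOn_pauliOp (i : ι) (P : PauliAxis) : ActsOn {i} (pauliOp i P) :=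
  actsOn_prodOp fun j hj => by
    rw [Finset.mem_singleton] at hj
    simp [hj]

theorem pauliOp_X_apply (i : ι) (x y : ι → Fin 2) :
    pauliOp i PauliAxis.X x y = if y = x + Pi.single i 1 then 1 else 0 := by
  simp only [pauliOp, prodOp, Matrix.of_apply]
  split_ifs with h
  · refine Finset.prod_eq_one fun j _ => ?_
    rw [h]
    by_cases hj : j = i
    · subst hj
      rw [Function.update_self, sigma_X, Pi.add_apply, Pi.single_eq_same]
      generalize x j = z
      fin_cases z <;> rfl
    · simp [hj]
  · obtain ⟨j, hj⟩ := Function.ne_iff.1 h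
    refine Finset.prod_eq_zero (Finset.mem_univ j) ?_
    by_cases hji : j = i
    · subst hji
      rw [Function.update_self, sigma_X]
      rw [Pi.add_apply, Pi.single_eq_same] at hj
      revert hj
      generalize x j = z
      generalize y j = z'
      fin_cases z <;> fin_cases z' <;> simp
    · rw [Pi.add_apply, Pi.single_eq_of_ne hji, add_zero] at hj
      simp [hji, hj.symm]

theorem pauliOp_Z_eq (i : ι) : pauliOp i PauliAxis.Z =
    Matrix.diagonal fun x : ι → Fin 2 => if x i = 0 then (1 : ℂ) else -1 := by
  ext x y
  simp only [pauliOp, prodOp, Matrix.of_apply, Matrix.diagonal_apply]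
  split_ifs with h h0
  · subst h
    refine Finset.prod_eq_one fun j _ => ?_
    by_cases hj : j = i
    · subst hj
      simp [sigma_Z, h0]
    · simp [hj]
  · subst h
    rw [Finset.prod_eq_single i]
    · have : x i = 1 := by omega
      simp [sigma_Z, this]
    · intro j _ hj
      simp [hj]
    · simp
  · obtain ⟨j, hj⟩ := Function.ne_iff.1 h
    refine Finset.prod_eq_zero (Finset.mem_univ j) ?_
    by_cases hji : j = i
    · subst hji
      rw [Function.update_self, sigma_Z]
      revert hj
      generalize x j = z
      generalize y j = z'
      fin_cases z <;> fin_cases z' <;> simp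
    · simp [hji, hj]

/-- An operator commuting with all `X` and `Z` is a scalar. -/
theorem eq_smul_one_of_commute (M : QOp ι)
    (hX : ∀ i, pauliOp i PauliAxis.X * M = M * pauliOp i PauliAxis.X)
    (hZ : ∀ i, pauliOp i PauliAxis.Z * M = M * pauliOp i PauliAxis.Z) :
    M = M 0 0 • (1 : QOp ι) := by
  -- Commuting with `X` makes the diagonal invariant under bit flips, hence constant; commuting with
  -- `Z` kills the off-diagonal entries.
  have hX' : ∀ i x, M (x + Pi.single i 1) (x + Pi.single i 1) = M x x := by
    intro i x
    have hinv : x + Pi.single i 1 + Pi.single i 1 = x := by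
      have : (1 : Fin 2) + 1 = 0 := rfl
      rw [add_assoc, ← Pi.single_add, this, Pi.single_zero, add_zero]
    have := congrFun (congrFun (hX i) x) (x + Pi.single i 1)
    simp only [Matrix.mul_apply, pauliOp_X_apply, ite_mul, one_mul, zero_mul, mul_ite, mul_one,
      mul_zero, Finset.sum_ite_eq', Finset.mem_univ, if_true] at this
    rw [this, Finset.sum_eq_single x]
    · simp
    · intro y _ hy
      rw [if_neg]
      exact fun h => hy (add_right_cancel h).symm
    · simp
  have hdiag : ∀ x, M x x = M 0 0 := by
    intro x
    rw [← Finset.univ_sum_single x]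
    induction (Finset.univ : Finset ι) using Finset.induction_on with
    | empty => simp
    | insert i s hi ih =>
      rw [Finset.sum_insert hi, add_comm]
      have h01 : x i = 0 ∨ x i = 1 := by omega
      rcases h01 with h | h
      · rw [h, Pi.single_zero, add_zero, ih]
      · rw [h, hX', ih]
  ext x y
  rw [Matrix.smul_apply, Matrix.one_apply]
  split_ifs with h
  · rw [h, hdiag]
    simp
  · obtain ⟨i, hi⟩ := Function.ne_iff.1 h
    have := congrFun (congrFun (hZ i) x) y
    rw [pauliOp_Z_eq, Matrix.diagonal_mul, Matrix.mul_diagonal] at this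
    rw [smul_zero]
    have h0 : x i = 0 ∨ x i = 1 := by omega
    have h1 : y i = 0 ∨ y i = 1 := by omega
    rcases h0 with h0 | h0 <;> rcases h1 with h1 | h1 <;> simp [h0, h1] at this hi
    · linear_combination this / 2
    · linear_combination -this / 2

theorem pauliOp_XZ_mul_self (i : ι) {P : PauliAxis} (hP : P = PauliAxis.X ∨ P = PauliAxis.Z) :
    pauliOp i P * pauliOp i P = 1 := by
  rw [pauliOp, prodOp_mul, ← prodOp_one, ← Function.update_mul, one_mul]
  congr 1
  have : sigma P * sigma P = 1 := by
    rcases hP with rfl | rfl <;> simp [sigma_X, sigma_Z, Matrix.one_fin_two]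
  rw [this]
  exact Function.update_eq_self i 1

theorem pauliOp_XZ_conjTranspose (i : ι) {P : PauliAxis}
    (hP : P = PauliAxis.X ∨ P = PauliAxis.Z) : (pauliOp i P)ᴴ = pauliOp i P := by
  rw [pauliOp, prodOp_conjTranspose]
  congr 1
  funext j
  by_cases hj : j = i
  · subst hj
    have : (sigma P)ᴴ = sigma P := by
      rcases hP with rfl | rfl <;> ext x y <;> fin_cases x <;> fin_cases y <;>
        simp [sigma_X, sigma_Z]
    simp [this]
  · simp [hj]

theorem pauliOp_X_mul_Z (i : ι) : pauliOp i PauliAxis.X * pauliOp i PauliAxis.Z =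
    -(pauliOp i PauliAxis.Z * pauliOp i PauliAxis.X) := by
  ext x y
  rw [Matrix.neg_apply, pauliOp_Z_eq, Matrix.diagonal_mul, Matrix.mul_diagonal, pauliOp_X_apply]
  by_cases h : y = x + Pi.single i 1
  · have h01 : x i = 0 ∨ x i = 1 := by omega
    subst h
    rcases h01 with h | h <;> simp [h]
  · simp [h]

/-- A unitary that almost commutes with all `X` and `Z` is close to a scalar. -/
theorem exists_smul_one_near (Q : QOp ι) {e : ℝ}
    (hQ : ∀ i P, ‖pauliOp i P * Q - Q * pauliOp i P‖ ≤ e) :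
    ∃ t : ℂ, ‖Q - t • (1 : QOp ι)‖ ≤ Fintype.card ι * e := by
  set l : List (QOp ι) := (Finset.univ.toList.map fun i : ι => pauliOp i PauliAxis.X) ++
    (Finset.univ.toList.map fun i : ι => pauliOp i PauliAxis.Z) with hl
  have hmem : ∀ P ∈ l, ∃ i p, (p = PauliAxis.X ∨ p = PauliAxis.Z) ∧ P = pauliOp i p := by
    intro P hP
    simp only [hl, List.mem_append, List.mem_map, Finset.mem_toList, Finset.mem_univ,
      true_and] at hP
    rcases hP with ⟨i, rfl⟩ | ⟨i, rfl⟩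
    · exact ⟨i, _, Or.inl rfl, rfl⟩
    · exact ⟨i, _, Or.inr rfl, rfl⟩
  have hlX : ∀ i, pauliOp i PauliAxis.X ∈ l := fun i => by simp [hl]
  have hlZ : ∀ i, pauliOp i PauliAxis.Z ∈ l := fun i => by simp [hl]
  -- Two involutions per qubit at cost `e / 2` each give the total `card ι * e`.
  have hlen : (l.length : ℝ) = 2 * Fintype.card ι := by
    simp [hl, Finset.card_univ]
    ring
  obtain ⟨M, hM, hMQ⟩ := exists_commute_of_almost_commute l (fun P hP => by
      obtain ⟨i, p, hp, rfl⟩ := hmem P hP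
      refine ⟨pauliOp_XZ_mul_self i hp, l2_opNorm_le_one ?_⟩
      rw [pauliOp_XZ_conjTranspose i hp, pauliOp_XZ_mul_self i hp]) (fun P hP P' hP' => by
      obtain ⟨i, p, hp, rfl⟩ := hmem P hP
      obtain ⟨j, q, hq, rfl⟩ := hmem P' hP'
      by_cases hij : i = j
      · subst hij
        rcases hp with rfl | rfl <;> rcases hq with rfl | rfl
        · exact Or.inl rfl
        · exact Or.inr (pauliOp_X_mul_Z i)
        · exact Or.inr (by rw [pauliOp_X_mul_Z, neg_neg])
        · exact Or.inl rfl
      · exact Or.inl ((actsOn_pauliOp i p).commute (actsOn_pauliOp j q) (by simp [hij])).eq) Q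
    (fun P hP => by
      obtain ⟨i, p, -, rfl⟩ := hmem P hP
      exact hQ i p)
  refine ⟨M 0 0, ?_⟩
  rw [← eq_smul_one_of_commute M (fun i => hM _ (hlX i)) (fun i => hM _ (hlZ i)), norm_sub_rev]
  refine hMQ.trans_eq ?_
  rw [hlen]
  ring

/-- Two unitaries with similar Heisenberg evolutions of all one-qubit Pauli operators agree
approximately up to a phase. -/
theorem exists_phase_near {U V : QOp ι} (hU : Uᴴ * U = 1) (hV : Vᴴ * V = 1) {e : ℝ}
    (h : ∀ i P, ‖Uᴴ * pauliOp i P * U - Vᴴ * pauliOp i P * V‖ ≤ e) :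
    ∃ t : ℂ, ‖t‖ = 1 ∧ ‖U - t • V‖ ≤ 2 * (Fintype.card ι * e) := by
  have hU' : U * Uᴴ = 1 := mul_eq_one_comm.1 hU
  have hV' : V * Vᴴ = 1 := mul_eq_one_comm.1 hV
  have hUn := l2_opNorm_le_one hU
  have hVn := l2_opNorm_le_one hV
  have hmul : ∀ A B C : QOp ι, ‖A‖ ≤ 1 → ‖C‖ ≤ 1 → ‖A * B * C‖ ≤ ‖B‖ := fun A B C hA hC => by
    calc ‖A * B * C‖ ≤ ‖A‖ * ‖B‖ * ‖C‖ := (norm_mul_le _ _).trans (by gcongr; exact norm_mul_le _ _)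
      _ ≤ 1 * ‖B‖ * 1 := by gcongr
      _ = ‖B‖ := by ring
  obtain ⟨s, hs⟩ := exists_smul_one_near (U * Vᴴ) (e := e) fun i P => by
    have : pauliOp i P * (U * Vᴴ) - U * Vᴴ * pauliOp i P =
        U * (Uᴴ * pauliOp i P * U - Vᴴ * pauliOp i P * V) * Vᴴ := by
      simp only [Matrix.mul_sub, Matrix.sub_mul]
      congr 1
      · simp only [← Matrix.mul_assoc, hU', Matrix.one_mul]
      · simp only [Matrix.mul_assoc, hV', Matrix.mul_one]
    rw [this]
    exact (hmul _ _ _ hUn (by rwa [Matrix.l2_opNorm_conjTranspose])).trans (h i P)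
  have hQ1 : ‖U * Vᴴ‖ = 1 := by
    apply CStarRing.norm_of_mem_unitary
    have : U * Vᴴ ∈ Matrix.unitaryGroup (ι → Fin 2) ℂ := by
      rw [Matrix.mem_unitaryGroup_iff', Matrix.star_eq_conjTranspose, Matrix.conjTranspose_mul,
        Matrix.conjTranspose_conjTranspose, Matrix.mul_assoc, ← Matrix.mul_assoc Uᴴ, hU,
        Matrix.one_mul, hV']
    exact this
  obtain ⟨t, ht, hst⟩ : ∃ t : ℂ, ‖t‖ = 1 ∧ s = ‖s‖ * t := by
    by_cases h0 : s = 0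
    · exact ⟨1, by simp, by simp [h0]⟩
    · have : (‖s‖ : ℂ) ≠ 0 := by simpa using h0
      refine ⟨s / ‖s‖, ?_, by field_simp⟩
      rw [norm_div, Complex.norm_real, norm_norm, div_self (by simpa using h0)]
  refine ⟨t, ht, ?_⟩
  have h1n : ‖(1 : QOp ι)‖ = 1 := norm_one
  -- As `U * Vᴴ` has norm `1`, the modulus of `s` is within the same error of `1`. Replacing `s` by
  -- its phase thus costs that error once more, which gives the factor `2`.
  have hst' : ‖s - t‖ ≤ Fintype.card ι * e := by
    have h1 : ‖s - t‖ = |‖s‖ - 1| := by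
      have : s - t = ((‖s‖ - 1 : ℝ) : ℂ) * t := by
        push_cast
        linear_combination hst
      rw [this, norm_mul, ht, mul_one, Complex.norm_real, Real.norm_eq_abs]
    have h2 := abs_norm_sub_norm_le (U * Vᴴ) (s • (1 : QOp ι))
    rw [hQ1, norm_smul, h1n, mul_one] at h2
    rw [h1, abs_sub_comm]
    exact h2.trans hs
  have hdec : U - t • V = (U * Vᴴ - s • (1 : QOp ι)) * V + (s - t) • V := by
    rw [Matrix.sub_mul, Matrix.mul_assoc, hV, Matrix.mul_one, Matrix.smul_mul, Matrix.one_mul]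
    module
  rw [hdec]
  refine (norm_add_le _ _).trans ?_
  have h1 : ‖(U * Vᴴ - s • (1 : QOp ι)) * V‖ ≤ ‖U * Vᴴ - s • (1 : QOp ι)‖ :=
    (norm_mul_le _ _).trans (mul_le_of_le_one_right (norm_nonneg _) hVn)
  have h2 : ‖(s - t) • V‖ ≤ ‖s - t‖ := by
    rw [norm_smul]
    exact mul_le_of_le_one_right (norm_nonneg _) hVn
  linarith

end Twirl

/-! ### Trace norm and diamond distance of unitary channels. -/

section TraceNorm

open scoped Matrix.Norms.L2Operator

variable {α : Type} [Fintype α] [DecidableEq α]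

theorem norm_star_dotProduct_mulVec_le (Y : Matrix α α ℂ) (b : α → ℂ) :
    ‖star b ⬝ᵥ (Y *ᵥ b)‖ ≤ ‖Y‖ * ∑ i, ‖b i‖ ^ 2 := by
  have h1 : star b ⬝ᵥ (Y *ᵥ b) =
      inner ℂ (WithLp.toLp 2 b) (WithLp.toLp 2 (Y *ᵥ b) : EuclideanSpace ℂ α) := by
    rw [EuclideanSpace.inner_eq_star_dotProduct, dotProduct_comm]
  have h2 := Matrix.l2_opNorm_mulVec Y (WithLp.toLp 2 b)
  have h3 : ‖(WithLp.toLp 2 b : EuclideanSpace ℂ α)‖ ^ 2 = ∑ i, ‖b i‖ ^ 2 :=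
    EuclideanSpace.norm_sq_eq _
  rw [h1]
  refine (norm_inner_le_norm _ _).trans ?_
  rw [← h3]
  have h4 : (WithLp.toLp 2 (Y *ᵥ b) : EuclideanSpace ℂ α) =
      WithLp.toLp 2 (Y *ᵥ (WithLp.toLp 2 b : EuclideanSpace ℂ α).ofLp) := rfl
  calc _ ≤ ‖(WithLp.toLp 2 b : EuclideanSpace ℂ α)‖ *
        (‖Y‖ * ‖(WithLp.toLp 2 b : EuclideanSpace ℂ α)‖) := by
        gcongr
        exact h2
    _ = _ := by ring

open scoped MatrixOrder in
-- Writing `ρ = B†B` turns the trace into a sum of quadratic forms of `Y` at the conjugated rows of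
-- `B`, whose squared norms sum to `1`.
theorem norm_trace_mul_le (Y : Matrix α α ℂ) {ρ : Matrix α α ℂ} (hρ : IsDensity ρ) :
    ‖(Y * ρ).trace‖ ≤ ‖Y‖ := by
  obtain ⟨B, hB⟩ := CStarAlgebra.nonneg_iff_eq_star_mul_self.1 hρ.1.nonneg
  rw [Matrix.star_eq_conjTranspose] at hB
  have htr : ∑ i, ∑ j, ‖B i j‖ ^ 2 = 1 := by
    have h1 := hρ.2
    rw [hB, Matrix.trace_mul_comm] at h1
    have : ((∑ i, ∑ j, ‖B i j‖ ^ 2 : ℝ) : ℂ) = 1 := by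
      rw [← h1]
      simp only [Matrix.trace, Matrix.diag, Matrix.mul_apply, Matrix.conjTranspose_apply]
      push_cast
      refine Finset.sum_congr rfl fun i _ => Finset.sum_congr rfl fun j _ => ?_
      exact (Complex.mul_conj' _).symm
    exact_mod_cast this
  have hexp : (Y * ρ).trace = ∑ i, star (star (B i)) ⬝ᵥ (Y *ᵥ star (B i)) := by
    rw [hB, ← Matrix.mul_assoc, Matrix.trace_mul_comm, ← Matrix.mul_assoc, Matrix.mul_assoc]
    simp only [Matrix.trace, Matrix.diag, star_star]
    rfl
  rw [hexp]
  calc _ ≤ ∑ i, ‖star (star (B i)) ⬝ᵥ (Y *ᵥ star (B i))‖ := norm_sum_le _ _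
    _ ≤ ∑ i, ‖Y‖ * ∑ j, ‖B i j‖ ^ 2 := by
        gcongr with i
        simpa using norm_star_dotProduct_mulVec_le Y (star (B i))
    _ = ‖Y‖ := by rw [← Finset.mul_sum, htr, mul_one]

/-- Both families are the roots of the characteristic polynomial, so they agree as multisets
whatever the diagonalization. -/
theorem sum_eigenvalues_congr {A : Matrix α α ℂ} (hA : A.IsHermitian) (E : Matrix α α ℂ)
    (hE : Eᴴ * E = 1) (d : α → ℝ) (h : A = E * Matrix.diagonal (fun i => (d i : ℂ)) * Eᴴ)
    (f : ℝ → ℝ) : ∑ i, f (hA.eigenvalues i) = ∑ i, f (d i) := by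
  have h1 := hA.roots_charpoly_eq_eigenvalues
  have h2 : A.charpoly.roots = Multiset.map (fun i => (d i : ℂ)) Finset.univ.val := by
    rw [h, Matrix.charpoly_mul_comm, ← Matrix.mul_assoc, hE, Matrix.one_mul,
      Matrix.charpoly_diagonal, Polynomial.roots_prod]
    · simp
    · simp [Finset.prod_ne_zero_iff, Polynomial.X_sub_C_ne_zero]
  rw [h1] at h2
  have h3 := congrArg (fun s => (s.map fun z : ℂ => f z.re).sum) h2
  simpa [Multiset.map_map] using h3

/-- Half of the duality between trace norm and operator norm: the sign of `M`, taken in an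
eigenbasis, attains the trace norm. -/
theorem traceNorm_le_of_isHermitian {M : Matrix α α ℂ} (hM : M.IsHermitian) {c : ℝ}
    (h : ∀ W : Matrix α α ℂ, ‖W‖ ≤ 1 → ‖(W * M).trace‖ ≤ c) : traceNorm M ≤ c := by
  set E : Matrix α α ℂ := (hM.eigenvectorUnitary : Matrix α α ℂ)
  have hE : Eᴴ * E = 1 := Matrix.mem_unitaryGroup_iff'.1 hM.eigenvectorUnitary.2
  have hE' : E * Eᴴ = 1 := mul_eq_one_comm.1 hE
  have hspec : M = E * Matrix.diagonal (fun i => (hM.eigenvalues i : ℂ)) * Eᴴ := by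
    conv_lhs => rw [hM.spectral_theorem]
    rfl
  have hsq : Mᴴ * M = E * Matrix.diagonal (fun i => ((hM.eigenvalues i ^ 2 : ℝ) : ℂ)) * Eᴴ := by
    rw [hM.eq]
    conv_lhs => rw [hspec]
    calc _ = E * (Matrix.diagonal (fun i => (hM.eigenvalues i : ℂ)) * (Eᴴ * E) *
          Matrix.diagonal (fun i => (hM.eigenvalues i : ℂ))) * Eᴴ := by
          simp only [Matrix.mul_assoc]
      _ = _ := by
          rw [hE, Matrix.mul_one, Matrix.diagonal_mul_diagonal]
          simp [sq]
  have htn : traceNorm M = ∑ i, |hM.eigenvalues i| := by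
    rw [traceNorm, sum_eigenvalues_congr (Matrix.isHermitian_conjTranspose_mul_self M) E hE _ hsq]
    simp [Real.sqrt_sq_eq_abs]
  set s : α → ℂ := fun i => ((SignType.sign (hM.eigenvalues i) : ℝ) : ℂ) with hs
  have hW : ‖E * Matrix.diagonal s * Eᴴ‖ ≤ 1 := by
    have hEn := l2_opNorm_le_one hE
    have hEn' : ‖Eᴴ‖ ≤ 1 := by rwa [Matrix.l2_opNorm_conjTranspose]
    have hd : ‖Matrix.diagonal s‖ ≤ 1 := by
      rw [Matrix.l2_opNorm_diagonal]
      refine (pi_norm_le_iff_of_nonneg zero_le_one).2 fun i => ?_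
      rcases lt_trichotomy (hM.eigenvalues i) 0 with h | h | h <;> simp [hs, h]
    calc _ ≤ ‖E‖ * ‖Matrix.diagonal s‖ * ‖Eᴴ‖ :=
          (norm_mul_le _ _).trans (by gcongr; exact norm_mul_le _ _)
      _ ≤ 1 * 1 * 1 := by gcongr
      _ = 1 := by norm_num
  have htr : (E * Matrix.diagonal s * Eᴴ * M).trace = ((∑ i, |hM.eigenvalues i| : ℝ) : ℂ) := by
    conv_lhs => rw [hspec]
    calc _ = ((E * (Matrix.diagonal s * (Eᴴ * E) *
          Matrix.diagonal (fun i => (hM.eigenvalues i : ℂ)))) * Eᴴ).trace := by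
          simp only [Matrix.mul_assoc]
      _ = _ := by
          rw [Matrix.trace_mul_comm, ← Matrix.mul_assoc, hE, Matrix.one_mul, Matrix.mul_one,
            Matrix.diagonal_mul_diagonal, Matrix.trace_diagonal]
          push_cast
          refine Finset.sum_congr rfl fun i _ => ?_
          rw [hs, ← Complex.ofReal_mul, sign_mul_self]
  have := h _ hW
  rw [htr, Complex.norm_real, Real.norm_eq_abs] at this
  rw [htn]
  exact (le_abs_self _).trans this

/-- The difference telescopes as `(A - B)ρA† + Bρ(A - B)†`. Tested against a contraction and rotated
under the trace, each term is at most `‖A - B‖`. -/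
theorem traceNorm_conj_sub_conj_le {A B ρ : Matrix α α ℂ} (hρ : IsDensity ρ) (hA : ‖A‖ ≤ 1)
    (hB : ‖B‖ ≤ 1) : traceNorm (A * ρ * Aᴴ - B * ρ * Bᴴ) ≤ 2 * ‖A - B‖ := by
  refine traceNorm_le_of_isHermitian ?_ fun W hW => ?_
  · exact (Matrix.isHermitian_mul_mul_conjTranspose A hρ.1.1).sub
      (Matrix.isHermitian_mul_mul_conjTranspose B hρ.1.1)
  · have hA' : ‖Aᴴ‖ ≤ 1 := by rwa [Matrix.l2_opNorm_conjTranspose]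
    have hAB : ‖(A - B)ᴴ‖ = ‖A - B‖ := Matrix.l2_opNorm_conjTranspose _
    have hdec : (W * (A * ρ * Aᴴ - B * ρ * Bᴴ)).trace =
        (Aᴴ * W * (A - B) * ρ).trace + ((A - B)ᴴ * W * B * ρ).trace := by
      have h1 : W * (A * ρ * Aᴴ - B * ρ * Bᴴ) =
          (W * (A - B) * ρ) * Aᴴ + (W * B * ρ) * (A - B)ᴴ := by
        simp only [Matrix.conjTranspose_sub, Matrix.mul_sub, Matrix.sub_mul, Matrix.mul_assoc]
        abel
      rw [h1, Matrix.trace_add, Matrix.trace_mul_comm, Matrix.trace_mul_comm _ (A - B)ᴴ]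
      simp only [Matrix.mul_assoc]
    rw [hdec]
    have h3 : ∀ X Y Z : Matrix α α ℂ, ‖X * Y * Z‖ ≤ ‖X‖ * ‖Y‖ * ‖Z‖ := fun X Y Z =>
      (norm_mul_le _ _).trans (by gcongr; exact norm_mul_le _ _)
    have h4 : ‖Aᴴ‖ * ‖W‖ * ‖A - B‖ ≤ 1 * 1 * ‖A - B‖ := by gcongr
    have h5 : ‖(A - B)ᴴ‖ * ‖W‖ * ‖B‖ ≤ ‖A - B‖ * 1 * 1 := by
      rw [hAB]
      gcongr
    refine (norm_add_le _ _).trans ?_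
    linarith [norm_trace_mul_le (Aᴴ * W * (A - B)) hρ, norm_trace_mul_le ((A - B)ᴴ * W * B) hρ,
      h3 Aᴴ W (A - B), h3 (A - B)ᴴ W B]

open scoped Kronecker in
-- Star homomorphisms of C⋆-algebras are contractive. This makes the bounds uniform in the reference
-- dimension.
theorem norm_kronecker_one_le {β : Type} [Fintype β] [DecidableEq β] (M : Matrix α α ℂ) :
    ‖M ⊗ₖ (1 : Matrix β β ℂ)‖ ≤ ‖M‖ := by
  let φ : Matrix α α ℂ →⋆ₙₐ[ℂ] Matrix (α × β) (α × β) ℂ :=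
    { toFun := fun M => M ⊗ₖ (1 : Matrix β β ℂ)
      map_smul' := fun r M => by simp [Matrix.smul_kronecker]
      map_zero' := by simp
      map_add' := fun M N => by simp [Matrix.add_kronecker]
      map_mul' := fun M N => by rw [← Matrix.mul_kronecker_mul, Matrix.one_mul]
      map_star' := fun M => by
        simp [Matrix.star_eq_conjTranspose, Matrix.conjTranspose_kronecker] }
  exact NonUnitalStarAlgHom.norm_apply_le φ M

variable {ι : Type} [Fintype ι] [DecidableEq ι]

open scoped Kronecker in
theorem tensorId_unitaryChannel (m : ℕ) (U : QOp ι)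
    (ρ : Matrix ((ι → Fin 2) × Fin m) ((ι → Fin 2) × Fin m) ℂ) :
    tensorId m (unitaryChannel U) ρ =
      (U ⊗ₖ (1 : Matrix (Fin m) (Fin m) ℂ)) * ρ * (U ⊗ₖ (1 : Matrix (Fin m) (Fin m) ℂ))ᴴ := by
  ext p q
  simp only [tensorId, unitaryChannel, LinearMap.coe_mk, AddHom.coe_mk, Matrix.of_apply,
    Matrix.mul_apply, Matrix.conjTranspose_apply, Fintype.sum_prod_type, Matrix.kroneckerMap_apply,
    Matrix.one_apply]
  simp [apply_ite (starRingEnd ℂ)]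

open scoped Kronecker in
theorem diamondDist_unitaryChannel_le {U V : QOp ι} (hU : Uᴴ * U = 1) (hV : Vᴴ * V = 1) {t : ℂ}
    (ht : ‖t‖ = 1) : diamondDist (unitaryChannel V) (unitaryChannel U) ≤
      ENNReal.ofReal (2 * ‖U - t • V‖) := by
  have htV : unitaryChannel V = unitaryChannel (t • V) := by
    refine LinearMap.ext fun ρ => ?_
    simp only [unitaryChannel, LinearMap.coe_mk, AddHom.coe_mk, Matrix.conjTranspose_smul,
      Matrix.smul_mul, Matrix.mul_smul, smul_smul]
    have : star t * t = 1 := by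
      rw [← starRingEnd_apply, Complex.conj_mul', ht]
      norm_num
    rw [this, one_smul]
  rw [htV]
  refine iSup_le fun m => iSup_le fun ρ => iSup_le fun hρ => ENNReal.ofReal_le_ofReal ?_
  rw [tensorId_unitaryChannel, tensorId_unitaryChannel]
  refine (traceNorm_conj_sub_conj_le hρ ?_ ?_).trans ?_
  · refine (norm_kronecker_one_le _).trans ?_
    rw [norm_smul, ht, one_mul]
    exact l2_opNorm_le_one hV
  · exact (norm_kronecker_one_le _).trans (l2_opNorm_le_one hU)
  · have hsub : U ⊗ₖ (1 : Matrix (Fin m) (Fin m) ℂ) - (t • V) ⊗ₖ (1 : Matrix (Fin m) (Fin m) ℂ) =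
        (U - t • V) ⊗ₖ (1 : Matrix (Fin m) (Fin m) ℂ) := by
      ext p q
      simp [sub_mul]
    rw [norm_sub_rev, hsub]
    gcongr
    exact norm_kronecker_one_le _

end TraceNorm

/-! ### Concentration of empirical means. -/

section Hoeffding

open ProbabilityTheory

variable {Ω : Type} [MeasurableSpace Ω] (μ : Measure Ω) [IsProbabilityMeasure μ]

/-- Hoeffding's inequality for independent copies of a variable with values in `[-1, 1]`. -/
theorem measureReal_pi_sum_ge_le {f : Ω → ℝ} (hf : Measurable f) (hb : ∀ x, |f x| ≤ 1) (N : ℕ)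
    {η : ℝ} (hη : 0 ≤ η) :
    (Measure.pi fun _ : Fin N => μ).real {T | N * η ≤ ∑ l, (f (T l) - ∫ x, f x ∂μ)} ≤
      Real.exp (-(N * η ^ 2 / 2)) := by
  have hind : iIndepFun (fun (l : Fin N) (T : Fin N → Ω) => f (T l) - ∫ x, f x ∂μ)
      (Measure.pi fun _ : Fin N => μ) :=
    iIndepFun_pi (X := fun _ x => f x - ∫ x, f x ∂μ) fun _ => (hf.sub_const _).aemeasurable
  have hsub : ∀ l ∈ (Finset.univ : Finset (Fin N)),
      HasSubgaussianMGF (fun T : Fin N → Ω => f (T l) - ∫ x, f x ∂μ) 1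
        (Measure.pi fun _ : Fin N => μ) := by
    intro l _
    have h := hasSubgaussianMGF_of_mem_Icc (μ := Measure.pi fun _ : Fin N => μ) (a := -1) (b := 1)
      (X := fun T : Fin N → Ω => f (T l)) (hf.comp (measurable_pi_apply l)).aemeasurable
      (Filter.Eventually.of_forall fun T => abs_le.1 (hb (T l)))
    have hint : ∫ T : Fin N → Ω, f (T l) ∂(Measure.pi fun _ : Fin N => μ) = ∫ x, f x ∂μ :=
      integral_comp_eval (μ := fun _ : Fin N => μ) hf.aestronglyMeasurable
    rw [hint] at h
    -- The variance proxy is the squared half-length of `[-1, 1]`, that is, `1`.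
    convert h using 1
    rw [← NNReal.coe_inj]
    norm_num
  refine (HasSubgaussianMGF.measure_sum_ge_le_of_iIndepFun hind hsub (by positivity)).trans ?_
  apply Real.exp_le_exp.2
  rcases Nat.eq_zero_or_pos N with rfl | hN
  · simp
  · have : (0 : ℝ) < N := by exact_mod_cast hN
    simp only [Finset.sum_const, Finset.card_univ, Fintype.card_fin, nsmul_eq_mul, mul_one,
      NNReal.coe_natCast]
    apply le_of_eq
    field_simp

/-- Two-sided Hoeffding inequality for finitely many functions at once. -/
theorem measureReal_pi_exists_abs_sum_gt_le {τ : Type} [Fintype τ] {f : τ → Ω → ℝ}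
    (hf : ∀ t, Measurable (f t)) (hb : ∀ t x, |f t x| ≤ 1) (N : ℕ) {η : ℝ} (hη : 0 ≤ η) :
    (Measure.pi fun _ : Fin N => μ).real
        {T | ∃ t, N * η < |∑ l, (f t (T l) - ∫ x, f t x ∂μ)|} ≤
      Fintype.card τ * (2 * Real.exp (-(N * η ^ 2 / 2))) := by
  have hsub : {T : Fin N → Ω | ∃ t, N * η < |∑ l, (f t (T l) - ∫ x, f t x ∂μ)|} ⊆
      ⋃ t, ({T | N * η ≤ ∑ l, (f t (T l) - ∫ x, f t x ∂μ)} ∪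
        {T | N * η ≤ ∑ l, (-f t (T l) - ∫ x, -f t x ∂μ)}) := by
    rintro T ⟨t, ht⟩
    refine Set.mem_iUnion.2 ⟨t, ?_⟩
    rcases lt_abs.1 ht with h | h
    · exact Or.inl h.le
    · refine Or.inr (h.le.trans_eq ?_)
      rw [← Finset.sum_neg_distrib]
      refine Finset.sum_congr rfl fun l _ => ?_
      rw [integral_neg]
      ring
  refine (measureReal_mono hsub).trans ((measureReal_iUnion_fintype_le _).trans ?_)
  rw [← nsmul_eq_mul (Fintype.card τ), ← Finset.card_univ, ← Finset.sum_const]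
  refine Finset.sum_le_sum fun t _ => (measureReal_union_le _ _).trans ?_
  have h1 := measureReal_pi_sum_ge_le μ (hf t) (hb t) N hη
  have h2 := measureReal_pi_sum_ge_le μ (f := fun x => -f t x) (hf t).neg
    (fun x => by rw [abs_neg]; exact hb t x) N hη
  linarith

end Hoeffding

/-! ### Local tests and what their means reveal. -/

section Tests

variable {n : ℕ}

/-- The statistics of a data point used by the learner: whether `K` chosen input qubits carry
prescribed stabilizer states, times the outcome of a chosen Pauli measurement of a chosen output
qubit. -/
abbrev TestIdx (n K : ℕ) : Type := ((Fin K → Fin n) × (Fin K → Stab)) × (Fin n × PauliAxis)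

/-- The outcome `±1` of a measurement in the basis `P`, or `0` if another basis was used. -/
def outcomeSign (P : PauliAxis) (b : Stab) : ℝ :=
  if b.1 = P then (if b.2 then -1 else 1) else 0

/-- Data points with the wrong inputs or basis score `0` instead of being discarded, so Hoeffding
applies to all `N` samples without conditioning. -/
def testFn {K : ℕ} (t : TestIdx n K) (s : Sample n) : ℝ :=
  if ∀ j, s.1 (t.1.1 j) = t.1.2 j then outcomeSign t.2.2 (s.2 t.2.1) else 0

theorem abs_testFn_le {K : ℕ} (t : TestIdx n K) (s : Sample n) : |testFn t s| ≤ 1 := by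
  unfold testFn outcomeSign
  split_ifs <;> simp

theorem card_pauliAxis : Fintype.card PauliAxis = 3 := rfl

theorem card_stab : Fintype.card Stab = 6 := rfl

theorem card_testIdx (n K : ℕ) :
    Fintype.card (TestIdx n K) = n ^ K * 6 ^ K * (n * 3) := by
  simp only [Fintype.card_prod, Fintype.card_fun, Fintype.card_fin, Fintype.card_bool,
    card_pauliAxis]

/-- The outcome labels record the measured axes, so exactly one choice of input, bases and signs
produces a given data point. -/
theorem sampleLaw_apply (U : Matrix.unitaryGroup (Fin n → Fin 2) ℂ) (s : Sample n) :
    (sampleLaw U s).toReal = (6 ^ n)⁻¹ * ((3 ^ n)⁻¹ * bornProb (U : QOp (Fin n)) s.1 s.2) := by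
  obtain ⟨ψ, φ⟩ := s
  have hφ : collapsed (fun i => (φ i).1) (fun i => (φ i).2) = φ := rfl
  have h1 : sampleLaw U (ψ, φ) = (6 ^ n : ℝ≥0∞)⁻¹ * ((3 ^ n : ℝ≥0∞)⁻¹ *
      ENNReal.ofReal (bornProb (U : QOp (Fin n)) ψ φ)) := by
    rw [sampleLaw, PMF.bind_apply, tsum_fintype, Finset.sum_eq_single ψ]
    · rw [PMF.bind_apply, tsum_fintype, Finset.sum_eq_single fun i => (φ i).1]
      · rw [PMF.map_apply, tsum_fintype, Finset.sum_eq_single fun i => (φ i).2]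
        · rw [if_pos (by rw [hφ]), outcomeLaw, PMF.ofFintype_apply, hφ]
          simp only [PMF.uniformOfFintype_apply, Fintype.card_fun, Fintype.card_fin, card_stab,
            card_pauliAxis]
          norm_cast
        · intro s _ hs
          refine if_neg fun h => hs ?_
          rw [show φ = _ from (Prod.ext_iff.1 h).2]
          rfl
        · simp
      · intro b _ hb
        rw [PMF.map_apply, tsum_fintype, Finset.sum_eq_zero, mul_zero]
        intro s _
        refine if_neg fun h => hb ?_
        rw [show φ = _ from (Prod.ext_iff.1 h).2]
        rfl
      · simp
    · intro ψ' _ hψ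
      rw [PMF.bind_apply, tsum_fintype, Finset.sum_eq_zero, mul_zero]
      intro b _
      rw [PMF.map_apply, tsum_fintype, Finset.sum_eq_zero, mul_zero]
      intro s _
      exact if_neg fun h => hψ (Prod.ext_iff.1 h).1.symm
    · simp
  rw [h1]
  have hb : 0 ≤ bornProb (U : QOp (Fin n)) ψ φ := by
    unfold bornProb
    positivity
  simp [ENNReal.toReal_ofReal hb]

/-- The mean signed outcome measures the Heisenberg-evolved Pauli operator. -/
theorem sum_outcomeSign_mul_bornProb (U : QOp (Fin n)) (ψ : Fin n → Stab) (i : Fin n)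
    (P : PauliAxis) :
    ((∑ φ, bornProb U ψ φ * outcomeSign P (φ i) : ℝ) : ℂ) =
      3 ^ n / 3 * stabExp (Uᴴ * pauliOp i P * U) ψ := by
  set v := U *ᵥ prodState ψ with hv
  have hR : stabExp (Uᴴ * pauliOp i P * U) ψ = ∑ x, ∑ y, star (v x) * v y * pauliOp i P x y := by
    have : stabExp (Uᴴ * pauliOp i P * U) ψ = star v ⬝ᵥ (pauliOp i P *ᵥ v) := by
      rw [stabExp, hv, Matrix.star_mulVec, ← Matrix.dotProduct_mulVec, Matrix.mulVec_mulVec,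
        Matrix.mulVec_mulVec]
    rw [this]
    simp only [dotProduct, Matrix.mulVec, Finset.mul_sum, Pi.star_apply]
    exact Finset.sum_congr rfl fun x _ => Finset.sum_congr rfl fun y _ => by ring
  have hborn : ∀ φ, ((bornProb U ψ φ : ℝ) : ℂ) =
      ∑ x, ∑ y, star (v x) * v y * (prodState φ x * star (prodState φ y)) := by
    intro φ
    rw [bornProb, ← hv, Complex.ofReal_pow, ← Complex.conj_mul', dotProduct, map_sum,
      Finset.sum_mul_sum]
    refine Finset.sum_congr rfl fun x _ => Finset.sum_congr rfl fun y _ => ?_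
    simp
    ring
  have hterm : ∀ x y : Fin n → Fin 2,
      ∑ φ : Fin n → Stab, (prodState φ x * star (prodState φ y)) * (outcomeSign P (φ i) : ℂ) =
        3 ^ n / 3 * pauliOp i P x y := by
    intro x y
    have h1 : ∀ φ : Fin n → Stab,
        (prodState φ x * star (prodState φ y)) * (outcomeSign P (φ i) : ℂ) =
        ∏ j, (stabVec (φ j) (x j) * star (stabVec (φ j) (y j)) *
          (if j = i then (outcomeSign P (φ j) : ℂ) else 1)) := by
      intro φ
      rw [Finset.prod_mul_distrib, Finset.prod_mul_distrib, Finset.prod_ite_eq' Finset.univ i,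
        if_pos (Finset.mem_univ i)]
      simp [prodState]
    simp only [h1]
    rw [← Fintype.prod_sum fun j b => stabVec b (x j) * star (stabVec b (y j)) *
      (if j = i then (outcomeSign P b : ℂ) else 1)]
    -- Away from `i` each of the three bases resolves the identity, giving `3`; at `i` only the
    -- basis `P` counts, giving `sigma P`. Hence the factor `3 ^ n / 3`.
    have h2 : ∀ j, ∑ b : Stab, stabVec b (x j) * star (stabVec b (y j)) *
        (if j = i then (outcomeSign P b : ℂ) else 1) =
        (if j = i then 1 else 3) * (Function.update 1 i (sigma P) : Fin n → _) j (x j) (y j) := by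
      intro j
      by_cases hj : j = i
      · subst hj
        simp only [if_true, one_mul, Function.update_self, sigma, Matrix.of_apply]
        rw [Fintype.sum_prod_type, Finset.sum_eq_single P]
        · refine Finset.sum_congr rfl fun s _ => ?_
          cases s <;> simp [outcomeSign]
        · intro q _ hq
          simp [outcomeSign, hq]
        · simp
      · simp only [hj, if_false, mul_one]
        rw [Fintype.sum_prod_type, Finset.sum_congr rfl fun p _ => stabVec_complete p (x j) (y j),
          Function.update_of_ne hj, Pi.one_apply, Matrix.one_apply, Finset.sum_const,
          Finset.card_univ, card_pauliAxis, nsmul_eq_mul]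
        norm_num
    simp only [h2, Finset.prod_mul_distrib]
    have h3 : (∏ j : Fin n, if j = i then (1 : ℂ) else 3) = 3 ^ n / 3 := by
      rw [eq_div_iff (by norm_num)]
      have h4 : (∏ j : Fin n, if j = i then (3 : ℂ) else 1) = 3 := by simp
      conv_lhs => rw [← h4]
      rw [← Finset.prod_mul_distrib]
      have : ∀ j : Fin n, (if j = i then (1 : ℂ) else 3) * (if j = i then 3 else 1) = 3 :=
        fun j => by split_ifs <;> norm_num
      simp [this]
    rw [h3]
    rfl
  rw [hR, Complex.ofReal_sum]
  simp only [Complex.ofReal_mul, hborn, Finset.sum_mul, Finset.mul_sum]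
  rw [Finset.sum_comm]
  refine Finset.sum_congr rfl fun x _ => ?_
  rw [Finset.sum_comm]
  refine Finset.sum_congr rfl fun y _ => ?_
  rw [mul_left_comm, ← hterm, Finset.mul_sum]
  exact Finset.sum_congr rfl fun φ _ => by ring

/-- The mean of a test whose selected input qubits contain the light cone of its output qubit. -/
theorem integral_testFn {K : ℕ} (U : Matrix.unitaryGroup (Fin n → Fin 2) ℂ) (i : Fin n)
    (P : PauliAxis) {S : Finset (Fin n)}
    (hS : ActsOn S ((U : QOp (Fin n))ᴴ * pauliOp i P * (U : QOp (Fin n))))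
    (t : Fin K → Fin n) (ht : ∀ j ∈ S, ∃ k, t k = j) (a : Fin n → Stab) :
    ((∫ s, testFn ((t, a ∘ t), (i, P)) s ∂(sampleLaw U).toMeasure : ℝ) : ℂ) =
      (6 ^ n)⁻¹ / 3 * (Finset.univ.filter fun ψ : Fin n → Stab => ∀ k, ψ (t k) = a (t k)).card *
        stabExp ((U : QOp (Fin n))ᴴ * pauliOp i P * (U : QOp (Fin n))) a := by
  rw [PMF.integral_eq_sum, Fintype.sum_prod_type]
  have h1 : ∀ ψ : Fin n → Stab, ∑ φ : Fin n → Stab,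
      (sampleLaw U (ψ, φ)).toReal • testFn ((t, a ∘ t), (i, P)) (ψ, φ) =
      if ∀ k, ψ (t k) = a (t k) then (6 ^ n)⁻¹ * ((3 ^ n)⁻¹ *
        ∑ φ, bornProb (U : QOp (Fin n)) ψ φ * outcomeSign P (φ i)) else 0 := by
    intro ψ
    simp only [sampleLaw_apply, testFn, smul_eq_mul, Function.comp_apply]
    split_ifs
    · simp only [Finset.mul_sum]
      exact Finset.sum_congr rfl fun φ _ => by ring
    · simp
  simp only [h1]
  rw [← Finset.sum_filter, Complex.ofReal_sum]
  rw [Finset.sum_congr rfl (g := fun _ => (6 ^ n)⁻¹ / 3 *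
    stabExp ((U : QOp (Fin n))ᴴ * pauliOp i P * (U : QOp (Fin n))) a), Finset.sum_const,
    nsmul_eq_mul]
  · ring
  · intro ψ hψ
    rw [Finset.mem_filter] at hψ
    have hcongr := stabExp_congr hS (a := ψ) (a' := a) fun j hj => by
      obtain ⟨k, rfl⟩ := ht j hj
      exact hψ.2 k
    rw [Complex.ofReal_mul, Complex.ofReal_mul, sum_outcomeSign_mul_bornProb, hcongr]
    push_cast
    field_simp

/-- At most `K` distinct qubits are prescribed, so at least a fraction `6 ^ (-K)` of the inputs
matches. -/
theorem pow_le_card_filter {K : ℕ} (t : Fin K → Fin n) (a : Fin n → Stab) :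
    6 ^ n ≤ 6 ^ K *
      (Finset.univ.filter fun ψ : Fin n → Stab => ∀ k, ψ (t k) = a (t k)).card := by
  set R : Finset (Fin n) := Finset.univ.image t with hR
  have hRc : R.card ≤ K := Finset.card_image_le.trans_eq (by simp)
  have hsub : (Fintype.piFinset fun i => if i ∈ R then {a i} else Finset.univ) ⊆
      Finset.univ.filter fun ψ : Fin n → Stab => ∀ k, ψ (t k) = a (t k) := by
    intro ψ hψ
    rw [Finset.mem_filter]
    refine ⟨Finset.mem_univ _, fun k => ?_⟩
    have := Fintype.mem_piFinset.1 hψ (t k)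
    rw [if_pos (Finset.mem_image_of_mem t (Finset.mem_univ k))] at this
    exact Finset.mem_singleton.1 this
  have hcard : (Fintype.piFinset fun i => if i ∈ R then {a i} else Finset.univ).card =
      6 ^ Rᶜ.card := by
    rw [Fintype.card_piFinset]
    simp only [apply_ite Finset.card, Finset.card_univ, card_stab, Finset.card_singleton]
    rw [Finset.prod_ite]
    simp [Finset.compl_eq_univ_sdiff, Finset.filter_notMem_eq_sdiff]
  calc 6 ^ n = 6 ^ R.card * 6 ^ Rᶜ.card := by
        rw [← pow_add, Finset.card_add_card_compl, Fintype.card_fin]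
    _ ≤ 6 ^ K * _ := by
        rw [← hcard]
        exact Nat.mul_le_mul (Nat.pow_le_pow_right (by norm_num) hRc) (Finset.card_le_card hsub)

open scoped Matrix.Norms.L2Operator in
/-- If the means of all tests are close for two unitaries with small light cones, then their
Heisenberg evolutions of one-qubit Pauli operators are close. -/
theorem norm_heisenberg_sub_le {K : ℕ} (U V : Matrix.unitaryGroup (Fin n → Fin 2) ℂ) (i : Fin n)
    (P : PauliAxis) {A B : Finset (Fin n)} (hAB : A.card + B.card ≤ K)
    (hA : ActsOn A ((U : QOp (Fin n))ᴴ * pauliOp i P * (U : QOp (Fin n))))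
    (hB : ActsOn B ((V : QOp (Fin n))ᴴ * pauliOp i P * (V : QOp (Fin n)))) {η : ℝ}
    (h : ∀ t : TestIdx n K, |∫ s, testFn t s ∂(sampleLaw U).toMeasure -
      ∫ s, testFn t s ∂(sampleLaw V).toMeasure| ≤ η) :
    ‖(U : QOp (Fin n))ᴴ * pauliOp i P * (U : QOp (Fin n)) -
      (V : QOp (Fin n))ᴴ * pauliOp i P * (V : QOp (Fin n))‖ ≤ 4 ^ K * (3 * 6 ^ K * η) := by
  set S := A ∪ B with hSdef
  have hSK : S.card ≤ K := (Finset.card_union_le A B).trans hAB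
  have hU := hA.mono (Finset.subset_union_left : A ⊆ S)
  have hV := hB.mono (Finset.subset_union_right : B ⊆ S)
  obtain ⟨f⟩ : Nonempty (S ↪ Fin K) :=
    Function.Embedding.nonempty_of_card_le (by simpa using hSK)
  -- The union of both light cones fills some of the `K` slots; the spare ones hold the dummy qubit
  -- `i`.
  set t : Fin K → Fin n := Function.extend f Subtype.val fun _ => i with ht
  have hts : ∀ j ∈ S, ∃ k, t k = j := fun j hj =>
    ⟨f ⟨j, hj⟩, f.injective.extend_apply _ _ _⟩
  have hη : 0 ≤ η := (abs_nonneg _).trans (h ((t, fun _ => (PauliAxis.X, false)), (i, P)))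
  have hexp : ∀ a, ‖stabExp ((U : QOp (Fin n))ᴴ * pauliOp i P * (U : QOp (Fin n)) -
      (V : QOp (Fin n))ᴴ * pauliOp i P * (V : QOp (Fin n))) a‖ ≤ 3 * 6 ^ K * η := by
    intro a
    rw [stabExp_sub]
    set g := stabExp ((U : QOp (Fin n))ᴴ * pauliOp i P * (U : QOp (Fin n))) a -
      stabExp ((V : QOp (Fin n))ᴴ * pauliOp i P * (V : QOp (Fin n))) a with hg
    set c := (Finset.univ.filter fun ψ : Fin n → Stab => ∀ k, ψ (t k) = a (t k)).card with hc
    have h1 : ‖((6 : ℂ) ^ n)⁻¹ / 3 * c * g‖ ≤ η := by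
      have h2 := h ((t, a ∘ t), (i, P))
      rw [← Real.norm_eq_abs, ← Complex.norm_real, Complex.ofReal_sub,
        integral_testFn U i P hU t hts a, integral_testFn V i P hV t hts a, ← mul_sub] at h2
      exact h2
    rw [norm_mul, norm_mul, norm_div, norm_inv, norm_pow, Complex.norm_natCast] at h1
    have h3 : (6 : ℝ) ^ n ≤ 6 ^ K * c := by exact_mod_cast pow_le_card_filter t a
    have h4 : ‖(6 : ℂ)‖ = 6 := by norm_num
    have h5 : ‖(3 : ℂ)‖ = 3 := by norm_num
    rw [h4, h5] at h1
    have h6 : (0 : ℝ) < 6 ^ n := by positivity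
    -- The matching fraction `c / 6 ^ n` is at least `6 ^ (-K)`, so undoing the normalization costs
    -- `3 * 6 ^ K`, independently of `n`.
    calc ‖g‖ = (6 ^ n)⁻¹ * 6 ^ n * ‖g‖ := by rw [inv_mul_cancel₀ h6.ne', one_mul]
      _ ≤ (6 ^ n)⁻¹ * (6 ^ K * c) * ‖g‖ := by gcongr
      _ = 3 * 6 ^ K * ((6 ^ n)⁻¹ / 3 * c * ‖g‖) := by ring
      _ ≤ 3 * 6 ^ K * η := by gcongr
  refine ((hU.sub hV).norm_le hexp).trans ?_
  gcongr
  norm_num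

end Tests

/-! ### Adding idle ancilla qubits to a circuit. -/

section AddQubits

open scoped Kronecker

variable {ι κ : Type}

/-- A gate on `ι`, seen as a gate on `ι ⊕ κ`. -/
noncomputable def QGate.inl [DecidableEq ι] [DecidableEq κ] (g : QGate ι) : QGate (ι ⊕ κ) where
  supp := g.supp.map Function.Embedding.inl
  supp_card := by
    rw [Finset.card_map]
    exact g.supp_card
  mat :=
    ⟨(g.mat : Matrix (g.supp → Fin 2) (g.supp → Fin 2) ℂ).submatrix
      ((g.supp.equivMap Function.Embedding.inl).symm.arrowCongr (Equiv.refl (Fin 2)))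
      ((g.supp.equivMap Function.Embedding.inl).symm.arrowCongr (Equiv.refl (Fin 2))), by
      rw [Matrix.mem_unitaryGroup_iff', Matrix.star_eq_conjTranspose,
        Matrix.conjTranspose_submatrix, Matrix.submatrix_mul_equiv, ← Matrix.star_eq_conjTranspose,
        Matrix.mem_unitaryGroup_iff'.1 g.mat.2, Matrix.submatrix_one_equiv]⟩

noncomputable def QLayer.inl [DecidableEq ι] [DecidableEq κ] (L : QLayer ι) : QLayer (ι ⊕ κ) where
  gates := L.gates.map QGate.inl
  disjoint := by
    rw [List.pairwise_map]
    exact L.disjoint.imp fun h => (Finset.disjoint_map _).2 h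

noncomputable def QCircuit.inl [DecidableEq ι] [DecidableEq κ] (c : QCircuit ι) : QCircuit (ι ⊕ κ) :=
  List.map QLayer.inl c

/-- The operator `M ⊗ N` on the register `ι ⊕ κ`. -/
def tensorOp (M : QOp ι) (N : QOp κ) : QOp (ι ⊕ κ) :=
  (M ⊗ₖ N).submatrix (Equiv.sumArrowEquivProdArrow ι κ (Fin 2))
    (Equiv.sumArrowEquivProdArrow ι κ (Fin 2))

theorem tensorOp_conjTranspose (M : QOp ι) (N : QOp κ) :
    (tensorOp M N)ᴴ = tensorOp Mᴴ Nᴴ := by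
  rw [tensorOp, Matrix.conjTranspose_submatrix, Matrix.conjTranspose_kronecker, tensorOp]

variable [Fintype ι] [DecidableEq ι] [Fintype κ] [DecidableEq κ]

theorem tensorOp_mul (M M' : QOp ι) (N N' : QOp κ) :
    tensorOp M N * tensorOp M' N' = tensorOp (M * M') (N * N') := by
  rw [tensorOp, tensorOp, Matrix.submatrix_mul_equiv, ← Matrix.mul_kronecker_mul, tensorOp]

omit [DecidableEq ι] [DecidableEq κ] in
theorem tensorOp_one_one : tensorOp (1 : QOp ι) (1 : QOp κ) = 1 := by
  rw [tensorOp, Matrix.one_kronecker_one, Matrix.submatrix_one_equiv]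

omit [Fintype ι] [DecidableEq ι] [DecidableEq κ] in
theorem tensorZeros_eq_tensorOp (ρ : QOp ι) :
    (tensorZeros ρ : QOp (ι ⊕ κ)) = tensorOp ρ (Matrix.single 0 0 1) := by
  ext x y
  simp only [tensorZeros, tensorOp, Matrix.of_apply, Matrix.submatrix_apply,
    Matrix.kroneckerMap_apply, Matrix.single_apply]
  have h : ∀ z : ι ⊕ κ → Fin 2, (0 = (Equiv.sumArrowEquivProdArrow ι κ (Fin 2) z).2) ↔
      ∀ j, z (Sum.inr j) = 0 := fun z => by
    rw [eq_comm, funext_iff]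
    rfl
  simp only [h, mul_ite, mul_one, mul_zero]
  rfl

theorem ancillaChannel_tensorOp_one (V : QOp ι) :
    ancillaChannel (tensorOp V (1 : QOp κ)) = unitaryChannel V := by
  refine LinearMap.ext fun ρ => ?_
  simp only [ancillaChannel, unitaryChannel, LinearMap.coe_mk, AddHom.coe_mk,
    tensorZeros_eq_tensorOp, tensorOp_conjTranspose, tensorOp_mul, Matrix.one_mul,
    Matrix.conjTranspose_one, Matrix.mul_one]
  ext x y
  simp only [traceOutRight, tensorOp, Matrix.of_apply, Matrix.submatrix_apply,
    Matrix.kroneckerMap_apply, Matrix.single_apply]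
  have h : ∀ (x : ι → Fin 2) (z : κ → Fin 2),
      Equiv.sumArrowEquivProdArrow ι κ (Fin 2) (Sum.elim x z) = (x, z) := fun x z => rfl
  simp [h]

theorem QGate.inl_toOp (g : QGate ι) :
    (g.inl : QGate (ι ⊕ κ)).toOp = tensorOp g.toOp 1 := by
  ext x y
  simp only [QGate.toOp, tensorOp, Matrix.of_apply, Matrix.submatrix_apply,
    Matrix.kroneckerMap_apply, Matrix.one_apply]
  have h1 : (∀ i, i ∉ (g.inl : QGate (ι ⊕ κ)).supp → x i = y i) ↔
      (∀ i, i ∉ g.supp → (Equiv.sumArrowEquivProdArrow ι κ (Fin 2) x).1 i =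
          (Equiv.sumArrowEquivProdArrow ι κ (Fin 2) y).1 i) ∧
        (Equiv.sumArrowEquivProdArrow ι κ (Fin 2) x).2 =
          (Equiv.sumArrowEquivProdArrow ι κ (Fin 2) y).2 := by
    rw [Sum.forall, funext_iff]
    refine and_congr (forall_congr' fun i => ?_) (forall_congr' fun j => ?_)
    · simp [QGate.inl, Equiv.sumArrowEquivProdArrow]
    · simp [QGate.inl, Equiv.sumArrowEquivProdArrow]
  by_cases h : ∀ i, i ∉ (g.inl : QGate (ι ⊕ κ)).supp → x i = y i
  · rw [if_pos h, if_pos (h1.1 h).2, mul_one, if_pos (h1.1 h).1]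
    rfl
  · rw [if_neg h]
    by_cases h2 : (Equiv.sumArrowEquivProdArrow ι κ (Fin 2) x).2 =
        (Equiv.sumArrowEquivProdArrow ι κ (Fin 2) y).2
    · rw [if_neg fun h3 => h (h1.2 ⟨h3, h2⟩), zero_mul]
    · rw [if_neg h2, mul_zero]

theorem QLayer.inl_toOp (L : QLayer ι) :
    (L.inl : QLayer (ι ⊕ κ)).toOp = tensorOp L.toOp 1 := by
  simp only [QLayer.toOp, QLayer.inl]
  induction L.gates with
  | nil => simp [tensorOp_one_one]
  | cons g l ih => simp only [List.map_cons, List.prod_cons, ih, QGate.inl_toOp, tensorOp_mul,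
      Matrix.one_mul]

theorem QCircuit.inl_toOp (c : QCircuit ι) :
    QCircuit.toOp (QCircuit.inl c : QCircuit (ι ⊕ κ)) = tensorOp (QCircuit.toOp c) 1 := by
  induction c with
  | nil => simp [QCircuit.toOp, QCircuit.inl, tensorOp_one_one]
  | cons L c ih =>
    have h1 : ∀ {ι : Type} [Fintype ι] [DecidableEq ι] (L : QLayer ι) (c : QCircuit ι),
        QCircuit.toOp (L :: c) = QCircuit.toOp c * L.toOp := by
      intros
      simp [QCircuit.toOp]
    have h2 : (QCircuit.inl (L :: c) : QCircuit (ι ⊕ κ)) = L.inl :: QCircuit.inl c := rfl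
    rw [h2, h1, h1, ih, QLayer.inl_toOp, tensorOp_mul, Matrix.one_mul]

end AddQubits

/-! ### The learner and its sample complexity. -/

section Learning

variable {n : ℕ}

/-- A unitary whose test means agree with the empirical test means up to `η`. -/
def IsConsistent (K : ℕ) {N : ℕ} (η : ℝ) (T : Fin N → Sample n)
    (V : Matrix.unitaryGroup (Fin n → Fin 2) ℂ) : Prop :=
  ∀ t : TestIdx n K,
    |∑ l, (testFn t (T l) - ∫ s, testFn t s ∂(sampleLaw V).toMeasure)| ≤ N * η

/-- The unknown unitary is consistent with its data with high probability. -/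
theorem measureReal_isConsistent_ge (K N : ℕ) {η : ℝ} (hη : 0 ≤ η)
    (U : Matrix.unitaryGroup (Fin n → Fin 2) ℂ) :
    1 - (n ^ K * 6 ^ K * (n * 3) : ℕ) * (2 * Real.exp (-(N * η ^ 2 / 2))) ≤
      (datasetLaw U N).real {T | IsConsistent K η T U} := by
  have h := measureReal_pi_exists_abs_sum_gt_le (sampleLaw U).toMeasure
    (f := fun t : TestIdx n K => testFn t) (fun t => measurable_of_finite _) abs_testFn_le N hη
  rw [card_testIdx] at h
  have hset : {T : Fin N → Sample n | IsConsistent K η T U} =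
      {T | ∃ t : TestIdx n K, N * η <
        |∑ l, (testFn t (T l) - ∫ s, testFn t s ∂(sampleLaw U).toMeasure)|}ᶜ := by
    ext T
    simp [IsConsistent]
  rw [hset, datasetLaw, probReal_compl_eq_one_sub (Set.toFinite _).measurableSet]
  linarith

/-- The deterministic half of the argument. With `K = 2 ^ (d + 1)`, the Heisenberg error is `4 ^ K *
3 * 6 ^ K * 2η`; it is multiplied by `2n` in `exists_phase_near` and by `2` in passing to the
diamond distance. -/
theorem diamondDist_le_of_isConsistent {d N : ℕ} (hN : 0 < N) {η : ℝ} {T : Fin N → Sample n}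
    {U V : Matrix.unitaryGroup (Fin n → Fin 2) ℂ}
    (hU : ∃ c : QCircuit (Fin n), c.depth ≤ d ∧ c.toOp = (U : QOp (Fin n)))
    (hV : ∃ c : QCircuit (Fin n), c.depth ≤ d ∧ c.toOp = (V : QOp (Fin n)))
    (hUT : IsConsistent (2 ^ (d + 1)) η T U) (hVT : IsConsistent (2 ^ (d + 1)) η T V) :
    diamondDist (unitaryChannel (V : QOp (Fin n))) (unitaryChannel (U : QOp (Fin n))) ≤
      ENNReal.ofReal (4 * 4 ^ 2 ^ (d + 1) * 6 ^ (2 ^ (d + 1) + 1) * n * η) := by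
  have hN' : (0 : ℝ) < N := by exact_mod_cast hN
  -- Both means lie within `η` of the same empirical mean.
  have hmean : ∀ t : TestIdx n (2 ^ (d + 1)), |∫ s, testFn t s ∂(sampleLaw U).toMeasure -
      ∫ s, testFn t s ∂(sampleLaw V).toMeasure| ≤ 2 * η := by
    intro t
    have h1 := hUT t
    have h2 := hVT t
    rw [Finset.sum_sub_distrib, Finset.sum_const, Finset.card_univ, Fintype.card_fin,
      nsmul_eq_mul] at h1 h2
    rw [abs_le] at h1 h2 ⊢
    constructor <;> refine le_of_mul_le_mul_left ?_ hN' <;> linarith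
  have hcone : ∀ W : Matrix.unitaryGroup (Fin n → Fin 2) ℂ,
      (∃ c : QCircuit (Fin n), c.depth ≤ d ∧ c.toOp = (W : QOp (Fin n))) → ∀ i P,
      ∃ S : Finset (Fin n), S.card ≤ 2 ^ d ∧
        ActsOn S ((W : QOp (Fin n))ᴴ * pauliOp i P * (W : QOp (Fin n))) := by
    rintro W ⟨c, hc, hcW⟩ i P
    obtain ⟨S, hS, hact⟩ := exists_actsOn_conj_circuit c {i} _ (actsOn_pauliOp i P)
    rw [Finset.card_singleton, mul_one] at hS
    exact ⟨S, hS.trans (Nat.pow_le_pow_right (by norm_num) hc), hcW ▸ hact⟩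
  obtain ⟨t, ht, hnear⟩ := exists_phase_near (Matrix.mem_unitaryGroup_iff'.1 U.2)
    (Matrix.mem_unitaryGroup_iff'.1 V.2) fun i P => by
      obtain ⟨A, hA, hA'⟩ := hcone U hU i P
      obtain ⟨B, hB, hB'⟩ := hcone V hV i P
      exact norm_heisenberg_sub_le U V i P (by rw [pow_succ]; omega) hA' hB' hmean
  refine (diamondDist_unitaryChannel_le (Matrix.mem_unitaryGroup_iff'.1 U.2)
    (Matrix.mem_unitaryGroup_iff'.1 V.2) ht).trans (ENNReal.ofReal_le_ofReal ?_)
  rw [Fintype.card_fin] at hnear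
  refine (mul_le_mul_of_nonneg_left hnear zero_le_two).trans_eq ?_
  ring

/-- The number of samples suffices for the union bound over all tests. -/
theorem failure_le (K n N : ℕ) {δ η : ℝ} (hδ : 0 < δ) (hδ' : δ < 1) (hn : 2 * δ ≤ n)
    (hN : 8 * (K + 1) * Real.log (n / δ) ≤ N * η ^ 2) :
    (n ^ K * 6 ^ K * (n * 3) : ℕ) * (2 * Real.exp (-(N * η ^ 2 / 2))) ≤ δ := by
  set r : ℝ := n / δ with hr
  have hr2 : 2 ≤ r := by rwa [hr, le_div_iff₀ hδ]
  have hr0 : 0 < r := by linarith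
  have hnr : (n : ℝ) = δ * r := by rw [hr]; field_simp
  have hnr' : (n : ℝ) ≤ r := by rw [hnr]; nlinarith
  have hexp : Real.exp (-(N * η ^ 2 / 2)) ≤ (r ^ (4 * (K + 1)))⁻¹ := by
    rw [← Real.exp_log (show 0 < r ^ (4 * (K + 1)) by positivity), ← Real.exp_neg,
      Real.exp_le_exp, Real.log_pow]
    push_cast
    linarith
  -- Since `r ≥ 2`, the numerical constants are absorbed into powers of `r`: `3(K + 1) + K + 1 = 4(K
  -- + 1)`, which is exactly the exponent that the sample size provides.
  have h6 : (6 : ℝ) ≤ r ^ 3 := by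
    have : (2 : ℝ) ^ 3 ≤ r ^ 3 := by gcongr
    linarith
  calc ((n ^ K * 6 ^ K * (n * 3) : ℕ) : ℝ) * (2 * Real.exp (-(N * η ^ 2 / 2)))
      ≤ ((n ^ K * 6 ^ K * (n * 3) : ℕ) : ℝ) * (2 * (r ^ (4 * (K + 1)))⁻¹) := by gcongr
    _ = 6 ^ (K + 1) * (n : ℝ) ^ K * (δ * r) * (r ^ (4 * (K + 1)))⁻¹ := by
        push_cast
        rw [← hnr]
        ring
    _ ≤ (r ^ 3) ^ (K + 1) * r ^ K * (δ * r) * (r ^ (4 * (K + 1)))⁻¹ := by gcongr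
    _ = δ * (r ^ (4 * (K + 1)) * (r ^ (4 * (K + 1)))⁻¹) := by ring
    _ = δ := by rw [mul_inv_cancel₀ (by positivity), mul_one]

theorem mainTheorem4 (d : ℕ) :
    ∃ (C : ℝ) (D : ℕ), 0 < C ∧
      ∀ (n N : ℕ) (δ ε : ℝ), 0 < δ → δ < 1 → 2 * δ ≤ n → 0 < ε →
        C * ((n : ℝ) ^ 2 * Real.log (n / δ) / ε ^ 2) ≤ N →
        ∃ learn : (Fin N → Sample n) → QCircuit (Fin n ⊕ Fin n),
          (∀ T, (learn T).depth ≤ D) ∧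
          ∀ U : Matrix.unitaryGroup (Fin n → Fin 2) ℂ,
            (∃ c : QCircuit (Fin n), c.depth ≤ d ∧ c.toOp = (U : QOp (Fin n))) →
            ENNReal.ofReal (1 - δ) ≤
              datasetLaw U N
                {T | diamondDist (ancillaChannel (learn T).toOp) (unitaryChannel (U : QOp (Fin n)))
                  ≤ ENNReal.ofReal ε} := by
  classical
  set K : ℕ := 2 ^ (d + 1) with hK
  set c₀ : ℝ := 4 * 4 ^ K * 6 ^ (K + 1) with hc₀
  have hc₀pos : 0 < c₀ := by positivity
  refine ⟨8 * (K + 1) * c₀ ^ 2, d, by positivity, ?_⟩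
  intro n N δ ε hδ hδ' hn hε hN
  have hn0 : (0 : ℝ) < n := by linarith
  have hlog : 0 < Real.log (n / δ) := Real.log_pos (by rw [lt_div_iff₀ hδ]; linarith)
  have hNpos : 0 < N := by
    have : (0 : ℝ) < N := lt_of_lt_of_le (by positivity) hN
    exact_mod_cast this
  -- Chosen so that the final bound `c₀ * n * η` equals `ε`.
  set η : ℝ := ε / (c₀ * n) with hη
  have hη0 : 0 ≤ η := by positivity
  have hNη : 8 * (K + 1) * Real.log (n / δ) ≤ N * η ^ 2 := by
    calc 8 * (K + 1) * Real.log (n / δ)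
        = 8 * (K + 1) * c₀ ^ 2 * ((n : ℝ) ^ 2 * Real.log (n / δ) / ε ^ 2) * η ^ 2 := by
          rw [hη]
          field_simp
      _ ≤ N * η ^ 2 := by gcongr
  let IsCandidate (T : Fin N → Sample n) (c : QCircuit (Fin n)) : Prop :=
    QCircuit.depth c ≤ d ∧ ∃ V : Matrix.unitaryGroup (Fin n → Fin 2) ℂ,
      QCircuit.toOp c = (V : QOp (Fin n)) ∧ IsConsistent K η T V
  -- The empty circuit is a dummy output for data that no candidate fits. Whenever `U` is consistent
  -- with the data, its own circuit is a candidate and this branch is not taken.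
  refine ⟨fun T => if h : ∃ c, IsCandidate T c then QCircuit.inl h.choose else [], fun T => ?_,
    fun U hU => ?_⟩
  · dsimp only
    split_ifs with h
    · exact (List.length_map _).trans_le h.choose_spec.1
    · exact Nat.zero_le d
  · have hprob := (sub_le_sub_left (failure_le K n N hδ hδ' hn hNη) 1).trans
      (measureReal_isConsistent_ge K N hη0 U)
    have : IsProbabilityMeasure (datasetLaw U N) := by
      unfold datasetLaw
      infer_instance
    refine (ENNReal.ofReal_le_ofReal hprob).trans ?_
    rw [ofReal_measureReal]
    refine measure_mono fun T hT => ?_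
    obtain ⟨c, hc, hcU⟩ := hU
    have hex : ∃ c, IsCandidate T c := ⟨c, hc, U, hcU, hT⟩
    obtain ⟨hdepth, V, hV, hVT⟩ := hex.choose_spec
    rw [Set.mem_ofPred_eq]
    dsimp only
    rw [dif_pos hex, QCircuit.inl_toOp, ancillaChannel_tensorOp_one, hV]
    refine (diamondDist_le_of_isConsistent hNpos ⟨c, hc, hcU⟩ ⟨_, hdepth, hV⟩ hT hVT).trans
      (ENNReal.ofReal_le_ofReal (le_of_eq ?_))
    rw [← hK, ← hc₀, hη]
    field_simp

end Learning
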